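/- Number the nodes of the Dynkin diagram of type $E_7$ as in Bourbaki (the chain $1 - 3 - 4 - 5 - 6 - 7$, with node $2$ attached to node $4$), let $\varpi_1, \dots, \varpi_7$ be the fundamental weights, and for a dominant weight $\lambda$ let $B(\lambda)$ denote the crystal of the irreducible highest weight module of highest weight $\lambda$. (When $\lambda = \lambda_1 + \dots + \lambda_r$ is a sum of minuscule dominant weights, as will be the case for all weights below, $B(\lambda)$ is the subcrystal of $B(\lambda_1) \otimes \cdots \otimes B(\lambda_r)$ generated by $u_{\lambda_1} \otimes \cdots \otimes u_{\lambda_r}$, where the minuscule crystal $B(\lambda_i)$ is the Weyl group orbit of $\lambda_i$.) Removing node $2$ leaves a Levi subalgebra of type $A_6$; denote by $\Lambda_1, \dots, \Lambda_6$ its fundamental weights, numbered so that $\Lambda_1, \Lambda_2, \Lambda_3, \Lambda_4, \Lambda_5, \Lambda_6$ correspond to the nodes $7, 6, 5, 4, 3, 1$ of $E_7$. Let $s \ge 0$ be an integer. Restricting the $E_7$-crystal $B(s\varpi_7)$ to the nodes $\{1,3,4,5,6,7\}$, one has an isomorphism of type $A_6$ crystals $$B(s\varpi_7) \cong \bigoplus_{m}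 B(\mu_m),$$ where the sum is over all tuples $m = (m_1, m_2, m_3, m_4, m_{4'}, m_5, m_6, m_7)$ of nonnegative integers such that $$m_2 \le m_6, \quad m_3 \le m_5, \quad m_4 + m_5 \le m_7, \quad \min(m_4, m_{4'}) = 0, \quad m_1 + m_2 + m_3 + m_4 + m_{4'} + m_5 + m_6 + m_7 = s,$$ and where $$\mu_m = (m_7 - m_4 - m_5)\Lambda_6 + (m_3 + m_{4'})\Lambda_5 + (m_5 - m_3)\Lambda_4 + m_2 \Lambda_3 + (m_6 - m_2)\Lambda_2 + m_1 \Lambda_1 .$$ Moreover, this decomposition is multiplicity free: the crystals $B(\mu_m)$ for distinct tuples $m$ are pairwise non-isomorphic. -/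

import Mathlib

namespace CrystalDecomp

/-- `k`-fold iterate of a partial operator, `none` playing the role of the formal element `0`. -/
def optIter {α : Type} (g : α → Option α) : ℕ → α → Option α
  | 0, b => some b
  | k + 1, b => (g b).bind (optIter g k)

/-- `n b` is the largest number of times the partial operator `g` can be applied to `b`. -/
def IsString {α : Type} (g : α → Option α) (n : α → ℕ) : Prop :=
  ∀ b, IsGreatest {k : ℕ | optIter g k b ≠ none} (n b)

theorem IsString.eq_zero {α : Type} {g : α → Option α} {n : α → ℕ} (h : IsString g n) {b : α}
    (hb : g b = none) : n b = 0 := by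
  have h1 := (h b).1
  cases hn : n b with
  | zero => rfl
  | succ k => simp [hn, optIter, hb] at h1

theorem IsString.eq_succ {α : Type} {g : α → Option α} {n : α → ℕ} (h : IsString g n) {b b' : α}
    (hb : g b = some b') : n b = n b' + 1 := by
  apply le_antisymm
  · have h1 := (h b).1
    cases hn : n b with
    | zero => omega
    | succ k =>
      have : k ∈ {k : ℕ | optIter g k b' ≠ none} := by
        simpa [hn, optIter, hb] using h1
      have := (h b').2 this
      omega
  · apply (h b).2
    have := (h b').1
    simpa [optIter, hb] using this

theorem IsString.of_step {α : Type} {g : α → Option α} {n : α → ℕ}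
    (h0 : ∀ b, g b = none → n b = 0) (h1 : ∀ b b', g b = some b' → n b = n b' + 1) :
    IsString g n := by
  have key : ∀ k b, optIter g k b ≠ none ↔ k ≤ n b := by
    intro k
    induction k with
    | zero => simp [optIter]
    | succ k ih =>
      intro b
      cases hb : g b with
      | none => simp [optIter, hb, h0 b hb]
      | some b' =>
        have := ih b'
        simp only [optIter, hb, Option.bind_some, h1 b b' hb]
        rw [this]; omega
  intro b
  refine ⟨(key _ _).2 le_rfl, fun k hk => (key _ _).1 hk⟩

/-- (Regular, i.e. seminormal) abstract crystals for the Cartan matrix `A = (⟨α_i^∨, α_j⟩)`.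
A weight is recorded by its values `⟨α_i^∨, wt⟩`, that is, by its coordinates in the basis of
fundamental weights; so the simple root `α_i` is the weight `j ↦ A j i`. The formal element `0` is
`none`; `eps` and `phi` are the string lengths `max {k | e_i^k b ≠ 0}` and `max {k | f_i^k b ≠ 0}`. -/
structure Crystal {I : Type} (A : Matrix I I ℤ) where
  carrier : Type
  e : I → carrier → Option carrier
  f : I → carrier → Option carrier
  wt : carrier → I → ℤ
  eps : I → carrier → ℕ
  phi : I → carrier → ℕ
  isString_e : ∀ i, IsString (e i) (eps i)
  isString_f : ∀ i, IsString (f i) (phi i)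
  phi_eq : ∀ i b, (phi i b : ℤ) = eps i b + wt b i
  f_eq_some_iff : ∀ i b b', f i b = some b' ↔ e i b' = some b
  wt_f : ∀ i b b', f i b = some b' → ∀ j, wt b' j = wt b j - A j i

namespace Crystal

variable {I J : Type} {A : Matrix I I ℤ} {A' : Matrix J J ℤ}

theorem eps_of_e (B : Crystal A) {i : I} {b b' : B.carrier} (h : B.e i b = some b') :
    B.eps i b = B.eps i b' + 1 := (B.isString_e i).eq_succ h

theorem phi_of_f (B : Crystal A) {i : I} {b b' : B.carrier} (h : B.f i b = some b') :
    B.phi i b = B.phi i b' + 1 := (B.isString_f i).eq_succ h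

theorem eps_of_f (B : Crystal A) {i : I} {b b' : B.carrier} (h : B.f i b = some b') :
    B.eps i b' = B.eps i b + 1 := B.eps_of_e ((B.f_eq_some_iff i _ _).1 h)

theorem phi_of_e (B : Crystal A) {i : I} {b b' : B.carrier} (h : B.e i b = some b') :
    B.phi i b' = B.phi i b + 1 := B.phi_of_f ((B.f_eq_some_iff i _ _).2 h)

/-- Isomorphisms of crystals: bijections that preserve weights and string lengths and commute with
all crystal operators (`0` being sent to `0`). -/
structure Iso (B C : Crystal A) where
  toEquiv : B.carrier ≃ C.carrier
  wt_eq : ∀ b, C.wt (toEquiv b) = B.wt b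
  eps_eq : ∀ i b, C.eps i (toEquiv b) = B.eps i b
  phi_eq : ∀ i b, C.phi i (toEquiv b) = B.phi i b
  map_e : ∀ i b, (B.e i b).map toEquiv = C.e i (toEquiv b)
  map_f : ∀ i b, (B.f i b).map toEquiv = C.f i (toEquiv b)

/-- The one-element crystal of weight `0`. -/
def trivial (A : Matrix I I ℤ) : Crystal A where
  carrier := Unit
  e _ _ := none
  f _ _ := none
  wt _ _ := 0
  eps _ _ := 0
  phi _ _ := 0
  isString_e _ := .of_step (by simp) (by simp)
  isString_f _ := .of_step (by simp) (by simp)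
  phi_eq := by simp
  f_eq_some_iff := by simp
  wt_f := by simp

/-- The tensor product `B ⊗ C`. The signature of `b ⊗ c` is `-^{φ(b)} +^{ε(b)} -^{φ(c)} +^{ε(c)}`,
consecutive pairs `+-` are deleted, `f_i` acts on the factor of the rightmost remaining `-` and
`e_i` on the factor of the leftmost remaining `+`. -/
def tensor (B C : Crystal A) : Crystal A where
  carrier := B.carrier × C.carrier
  e i x := if C.phi i x.2 < B.eps i x.1 then (B.e i x.1).map (fun b => (b, x.2))
    else (C.e i x.2).map (fun c => (x.1, c))
  f i x := if B.eps i x.1 < C.phi i x.2 then (C.f i x.2).map (fun c => (x.1, c))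
    else (B.f i x.1).map (fun b => (b, x.2))
  wt x j := B.wt x.1 j + C.wt x.2 j
  eps i x := C.eps i x.2 + (B.eps i x.1 - C.phi i x.2)
  phi i x := B.phi i x.1 + (C.phi i x.2 - B.eps i x.1)
  isString_e i := .of_step
    (fun x h => by
      split_ifs at h with h1
      · have := (B.isString_e i).eq_zero (Option.map_eq_none_iff.1 h)
        omega
      · have := (C.isString_e i).eq_zero (Option.map_eq_none_iff.1 h)
        omega)
    (fun x y h => by
      split_ifs at h with h1
      · obtain ⟨b, hb, rfl⟩ := Option.map_eq_some_iff.1 h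
        have := B.eps_of_e hb
        grind
      · obtain ⟨c, hc, rfl⟩ := Option.map_eq_some_iff.1 h
        have := C.eps_of_e hc
        have := C.phi_of_e hc
        grind)
  isString_f i := .of_step
    (fun x h => by
      split_ifs at h with h1
      · have := (C.isString_f i).eq_zero (Option.map_eq_none_iff.1 h)
        omega
      · have := (B.isString_f i).eq_zero (Option.map_eq_none_iff.1 h)
        omega)
    (fun x y h => by
      split_ifs at h with h1
      · obtain ⟨c, hc, rfl⟩ := Option.map_eq_some_iff.1 h
        have := C.phi_of_f hc
        grind
      · obtain ⟨b, hb, rfl⟩ := Option.map_eq_some_iff.1 h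
        have := B.eps_of_f hb
        have := B.phi_of_f hb
        grind)
  phi_eq i x := by
    have h1 := B.phi_eq i x.1
    have h2 := C.phi_eq i x.2
    push_cast
    omega
  f_eq_some_iff i x y := by
    constructor
    · intro h
      split_ifs at h with h1
      · obtain ⟨c, hc, rfl⟩ := Option.map_eq_some_iff.1 h
        have h2 := C.phi_of_f hc
        rw [if_neg (by simp only; omega)]
        simp [(C.f_eq_some_iff i _ _).1 hc]
      · obtain ⟨b, hb, rfl⟩ := Option.map_eq_some_iff.1 h
        have h2 := B.eps_of_f hb
        rw [if_pos (by simp only; omega)]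
        simp [(B.f_eq_some_iff i _ _).1 hb]
    · intro h
      split_ifs at h with h1
      · obtain ⟨b, hb, rfl⟩ := Option.map_eq_some_iff.1 h
        have h2 := B.eps_of_e hb
        rw [if_neg (by simp only; omega)]
        simp [(B.f_eq_some_iff i _ _).2 hb]
      · obtain ⟨c, hc, rfl⟩ := Option.map_eq_some_iff.1 h
        have h2 := C.phi_of_e hc
        rw [if_pos (by simp only; omega)]
        simp [(C.f_eq_some_iff i _ _).2 hc]
  wt_f i x y h j := by
    split_ifs at h with h1
    · obtain ⟨c, hc, rfl⟩ := Option.map_eq_some_iff.1 h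
      simp only [C.wt_f i _ _ hc j]
      ring
    · obtain ⟨b, hb, rfl⟩ := Option.map_eq_some_iff.1 h
      simp only [B.wt_f i _ _ hb j]
      ring

/-- Restriction to the Levi subalgebra whose simple roots are those with index in the image of `ι`,
relabelled along `ι`. -/
def restrict (B : Crystal A) (ι : J → I) (hι : ∀ j k, A (ι j) (ι k) = A' j k) : Crystal A' where
  carrier := B.carrier
  e j := B.e (ι j)
  f j := B.f (ι j)
  wt b j := B.wt b (ι j)
  eps j := B.eps (ι j)
  phi j := B.phi (ι j)
  isString_e j := B.isString_e (ι j)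
  isString_f j := B.isString_f (ι j)
  phi_eq j := B.phi_eq (ι j)
  f_eq_some_iff j := B.f_eq_some_iff (ι j)
  wt_f j b b' h k := by rw [B.wt_f (ι j) b b' h, hι]

/-- The direct sum (disjoint union) of a family of crystals. -/
def directSum {K : Type} (B : K → Crystal A) : Crystal A where
  carrier := Σ k, (B k).carrier
  e i x := ((B x.1).e i x.2).map (Sigma.mk x.1)
  f i x := ((B x.1).f i x.2).map (Sigma.mk x.1)
  wt x := (B x.1).wt x.2
  eps i x := (B x.1).eps i x.2
  phi i x := (B x.1).phi i x.2
  isString_e i := .of_step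
    (fun x h => ((B x.1).isString_e i).eq_zero (by simpa using h))
    (fun x y h => by
      obtain ⟨b, hb, rfl⟩ := Option.map_eq_some_iff.1 h
      exact ((B x.1).isString_e i).eq_succ hb)
  isString_f i := .of_step
    (fun x h => ((B x.1).isString_f i).eq_zero (by simpa using h))
    (fun x y h => by
      obtain ⟨b, hb, rfl⟩ := Option.map_eq_some_iff.1 h
      exact ((B x.1).isString_f i).eq_succ hb)
  phi_eq i x := (B x.1).phi_eq i x.2
  f_eq_some_iff i x y := by
    constructor
    · intro h
      obtain ⟨b, hb, rfl⟩ := Option.map_eq_some_iff.1 h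
      simp [((B x.1).f_eq_some_iff i _ _).1 hb]
    · intro h
      obtain ⟨b, hb, rfl⟩ := Option.map_eq_some_iff.1 h
      simp [((B y.1).f_eq_some_iff i _ _).2 hb]
  wt_f i x y h j := by
    obtain ⟨b, hb, rfl⟩ := Option.map_eq_some_iff.1 h
    exact (B x.1).wt_f i _ _ hb j

/-- `c` can be obtained from `b` by applying crystal operators. -/
inductive Reach (B : Crystal A) (b : B.carrier) : B.carrier → Prop
  | refl : Reach B b b
  | e {c c' : B.carrier} (i : I) : Reach B b c → B.e i c = some c' → Reach B b c'
  | f {c c' : B.carrier} (i : I) : Reach B b c → B.f i c = some c' → Reach B b c'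

theorem pmap_eq_some {α : Type} {P : α → Prop} {o : Option α} {h : ∀ a, o = some a → P a}
    {y : {a // P a}} :
    o.pmap (fun a ha => (⟨a, ha⟩ : {a // P a})) h = some y ↔ o = some y.1 := by
  cases o with
  | none => simp
  | some a => simp [Subtype.ext_iff]

/-- The subcrystal generated by an element, i.e. its connected component. -/
def component (B : Crystal A) (b : B.carrier) : Crystal A where
  carrier := {c : B.carrier // B.Reach b c}
  e i x := (B.e i x.1).pmap (fun c hc => ⟨c, hc⟩) (fun _ hc => .e i x.2 hc)
  f i x := (B.f i x.1).pmap (fun c hc => ⟨c, hc⟩) (fun _ hc => .f i x.2 hc)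
  wt x := B.wt x.1
  eps i x := B.eps i x.1
  phi i x := B.phi i x.1
  isString_e i := .of_step
    (fun x h => (B.isString_e i).eq_zero (by simpa using h))
    (fun x y h => (B.isString_e i).eq_succ (pmap_eq_some.1 h))
  isString_f i := .of_step
    (fun x h => (B.isString_f i).eq_zero (by simpa using h))
    (fun x y h => (B.isString_f i).eq_succ (pmap_eq_some.1 h))
  phi_eq i x := B.phi_eq i x.1
  f_eq_some_iff i x y := by
    rw [pmap_eq_some, pmap_eq_some]
    exact B.f_eq_some_iff i x.1 y.1
  wt_f i x y h j := B.wt_f i _ _ (pmap_eq_some.1 h) j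

end Crystal

/-- Membership in the Weyl group orbit of `l`: the weights obtained from `l` by successive simple
reflections `s_i μ = μ - ⟨α_i^∨, μ⟩ α_i`. -/
inductive WeylOrbit {I : Type} (A : Matrix I I ℤ) (l : I → ℤ) : (I → ℤ) → Prop
  | base : WeylOrbit A l l
  | reflect {μ : I → ℤ} (i : I) : WeylOrbit A l μ → WeylOrbit A l (fun j => μ j - μ i * A j i)

/-- A dominant weight is minuscule if all simple coroots take only the values `-1, 0, 1` on its
Weyl group orbit. -/
structure IsMinuscule {I : Type} (A : Matrix I I ℤ) (l : I → ℤ) : Prop where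
  dominant : ∀ i, 0 ≤ l i
  bounds : ∀ μ, WeylOrbit A l μ → ∀ i, -1 ≤ μ i ∧ μ i ≤ 1

/-- The crystal `B(l)` of a minuscule dominant weight: its elements are the weights in the Weyl
group orbit of `l`, and `f_i μ = μ - α_i` if `⟨α_i^∨, μ⟩ = 1`, `e_i μ = μ + α_i` if
`⟨α_i^∨, μ⟩ = -1`, and `f_i μ = 0`, `e_i μ = 0` otherwise. -/
def minusculeCrystal {I : Type} (A : Matrix I I ℤ) (hA : ∀ i, A i i = 2) (l : I → ℤ)
    (hl : IsMinuscule A l) : Crystal A where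
  carrier := {μ : I → ℤ // WeylOrbit A l μ}
  e i μ := if h : μ.1 i = -1 then
      some ⟨fun j => μ.1 j + A j i, by simpa [h] using WeylOrbit.reflect i μ.2⟩ else none
  f i μ := if h : μ.1 i = 1 then
      some ⟨fun j => μ.1 j - A j i, by simpa [h] using WeylOrbit.reflect i μ.2⟩ else none
  wt μ := μ.1
  eps i μ := (-μ.1 i).toNat
  phi i μ := (μ.1 i).toNat
  isString_e i := .of_step
    (fun μ h => by
      have := hl.bounds μ.1 μ.2 i
      simp at h
      omega)
    (fun μ ν h => by
      have := hA i
      split_ifs at h with h1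
      obtain rfl := Option.some.inj h
      simp [h1, this])
  isString_f i := .of_step
    (fun μ h => by
      have := hl.bounds μ.1 μ.2 i
      simp at h
      omega)
    (fun μ ν h => by
      have := hA i
      split_ifs at h with h1
      obtain rfl := Option.some.inj h
      simp [h1, this])
  phi_eq i μ := by omega
  f_eq_some_iff i μ ν := by
    have hi := hA i
    constructor
    · intro h
      split_ifs at h with h1
      obtain rfl := Option.some.inj h
      simp [h1, hi]
    · intro h
      split_ifs at h with h1
      obtain rfl := Option.some.inj h
      simp [h1, hi]
  wt_f i μ ν h j := by
    split_ifs at h with h1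
    obtain rfl := Option.some.inj h
    rfl

/-- The tensor product `B(l_1) ⊗ ⋯ ⊗ B(l_r)` of minuscule crystals. -/
def minusculeTensor {I : Type} (A : Matrix I I ℤ) (hA : ∀ i, A i i = 2) :
    List {l : I → ℤ // IsMinuscule A l} → Crystal A
  | [] => Crystal.trivial A
  | l :: L => (minusculeCrystal A hA l.1 l.2).tensor (minusculeTensor A hA L)

/-- The element `u_{l_1} ⊗ ⋯ ⊗ u_{l_r}` of `B(l_1) ⊗ ⋯ ⊗ B(l_r)`, of weight `l_1 + ⋯ + l_r`. -/
def topElement {I : Type} (A : Matrix I I ℤ) (hA : ∀ i, A i i = 2) :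
    (L : List {l : I → ℤ // IsMinuscule A l}) → (minusculeTensor A hA L).carrier
  | [] => ()
  | l :: L => (⟨l.1, .base⟩, topElement A hA L)

/-- The highest weight crystal `B(l_1 + ⋯ + l_r)`, for minuscule dominant weights `l_1, …, l_r` (of
a root system of finite type): the subcrystal of `B(l_1) ⊗ ⋯ ⊗ B(l_r)` generated by
`u_{l_1} ⊗ ⋯ ⊗ u_{l_r}`. -/
def highestWeightCrystal {I : Type} (A : Matrix I I ℤ) (hA : ∀ i, A i i = 2)
    (L : List {l : I → ℤ // IsMinuscule A l}) : Crystal A :=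
  (minusculeTensor A hA L).component (topElement A hA L)

/-- A criterion: in simply-laced finite type, a dominant weight `l` of squared length less than `4`
(simple roots having squared length `2`) is minuscule. -/
theorem isMinuscule_of_posSemidef {I : Type} [Fintype I] [DecidableEq I] {A : Matrix I I ℤ}
    (hA : ∀ i, A i i = 2) (hs : ∀ i j, A i j = A j i) (hp : ∀ x : I → ℤ, 0 ≤ x ⬝ᵥ A.mulVec x)
    {l : I → ℤ} (hl : ∀ i, 0 ≤ l i) {N : ℤ} (hN : 0 < N) {x : I → ℤ}
    (hx : A.mulVec x = N • l) (hq : x ⬝ᵥ l < 2 * N) : IsMinuscule A l := by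
  have hcol : ∀ (y : I → ℤ) (i : I), (y ⬝ᵥ fun j => A j i) = A.mulVec y i := by
    intro y i
    rw [Matrix.mulVec, dotProduct_comm]
    exact congrArg (· ⬝ᵥ y) (funext fun j => hs j i)
  refine ⟨hl, fun μ hμ => ?_⟩
  obtain ⟨y, hy, hyq⟩ : ∃ y : I → ℤ, A.mulVec y = N • μ ∧ y ⬝ᵥ μ < 2 * N := by
    induction hμ with
    | base => exact ⟨x, hx, hq⟩
    | @reflect μ i _ ih =>
      obtain ⟨y, hy, hyq⟩ := ih
      have hcoli : A.mulVec (Pi.single i 1) = fun j => A j i := by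
        ext j; simp
      have hμ' : (fun j => μ j - μ i * A j i) = μ - μ i • fun j => A j i := by
        ext j; simp
      refine ⟨y - (N * μ i) • Pi.single i 1, ?_, ?_⟩
      · rw [hμ', Matrix.mulVec_sub, Matrix.mulVec_smul, hy, hcoli]
        ext j; simp; ring
      · rw [hμ', sub_dotProduct, dotProduct_sub, dotProduct_smul, hcol, hy, smul_dotProduct,
          single_dotProduct]
        simp only [Pi.sub_apply, Pi.smul_apply, hA, smul_eq_mul]
        linarith
  intro i
  have h := hp (2 • y - (N * μ i) • Pi.single i 1)
  have hcoli : A.mulVec (Pi.single i 1) = fun j => A j i := by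
    ext j; simp
  rw [Matrix.mulVec_sub, Matrix.mulVec_smul, Matrix.mulVec_smul, hcoli, hy, sub_dotProduct,
    dotProduct_sub, dotProduct_smul, smul_dotProduct, smul_dotProduct, dotProduct_sub,
    dotProduct_smul, dotProduct_smul, hcol, hy, smul_dotProduct, smul_dotProduct,
    single_dotProduct, single_dotProduct] at h
  simp only [Pi.smul_apply, hA, smul_eq_mul, nsmul_eq_mul] at h
  push_cast at h
  have h3 : N * (2 * (y ⬝ᵥ μ) - N * (μ i) ^ 2) * 2 ≥ 0 := by linarith
  have h4 : 2 * (y ⬝ᵥ μ) - N * (μ i) ^ 2 ≥ 0 := by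
    by_contra! hneg
    nlinarith
  have h5 : (μ i) ^ 2 < 4 := by nlinarith
  constructor <;> nlinarith

/-! ### Type `E₇` -/

theorem diag_E₇ : ∀ i, CartanMatrix.E₇ i i = 2 := by decide

theorem posSemidef_E₇ (x : Fin 7 → ℤ) : 0 ≤ x ⬝ᵥ CartanMatrix.E₇.mulVec x := by
  have h : 12 * (x ⬝ᵥ CartanMatrix.E₇.mulVec x) = 6 * (2 * x 0 - x 2) ^ 2
      + 2 * (3 * x 2 - 2 * x 3) ^ 2 + 6 * (2 * x 1 - x 3) ^ 2 + 6 * (2 * x 6 - x 5) ^ 2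
      + 2 * (3 * x 5 - 2 * x 4) ^ 2 + (4 * x 4 - 3 * x 3) ^ 2 + x 3 ^ 2 := by
    simp [CartanMatrix.E₇, Matrix.mulVec, dotProduct, Fin.sum_univ_succ]
    ring
  have : 0 ≤ 12 * (x ⬝ᵥ CartanMatrix.E₇.mulVec x) := by rw [h]; positivity
  linarith

/-- The seventh fundamental weight of `E₇` (nodes numbered as in Bourbaki) is minuscule. -/
theorem isMinuscule_E₇ : IsMinuscule CartanMatrix.E₇ (Pi.single 6 1) :=
  isMinuscule_of_posSemidef diag_E₇ (fun i j => by fin_cases i <;> fin_cases j <;> rfl) posSemidef_E₇ (by decide) (N := 2) (by decide)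
    (x := ![2, 3, 4, 6, 5, 4, 3]) (by decide) (by decide)

/-- The `E₇`-crystal `B(s ϖ₇)`. -/
def crystalE₇ (s : ℕ) : Crystal CartanMatrix.E₇ :=
  highestWeightCrystal CartanMatrix.E₇ diag_E₇ (List.replicate s ⟨Pi.single 6 1, isMinuscule_E₇⟩)

/-! ### Type `A₆` -/

theorem diag_A₆ : ∀ i, CartanMatrix.A 6 i i = 2 := by decide

theorem posSemidef_A₆ (x : Fin 6 → ℤ) : 0 ≤ x ⬝ᵥ (CartanMatrix.A 6).mulVec x := by
  have hA : CartanMatrix.A 6 = !![2, -1, 0, 0, 0, 0; -1, 2, -1, 0, 0, 0; 0, -1, 2, -1, 0, 0;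
      0, 0, -1, 2, -1, 0; 0, 0, 0, -1, 2, -1; 0, 0, 0, 0, -1, 2] := by
    ext i j
    fin_cases i <;> fin_cases j <;> rfl
  have h : x ⬝ᵥ (CartanMatrix.A 6).mulVec x = x 0 ^ 2 + (x 0 - x 1) ^ 2 + (x 1 - x 2) ^ 2
      + (x 2 - x 3) ^ 2 + (x 3 - x 4) ^ 2 + (x 4 - x 5) ^ 2 + x 5 ^ 2 := by
    simp [hA, Matrix.mulVec, dotProduct, Fin.sum_univ_succ]
    ring
  rw [h]
  positivity

/-- All fundamental weights in type `A₆` are minuscule. -/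
theorem isMinuscule_A₆ (k : Fin 6) : IsMinuscule (CartanMatrix.A 6) (Pi.single k 1) :=
  isMinuscule_of_posSemidef diag_A₆ (fun i j => by fin_cases i <;> fin_cases j <;> rfl) posSemidef_A₆ (by revert k; decide) (N := 7)
    (by decide)
    (x := fun j => ((min j.val k.val : ℕ) + 1 : ℤ) * (6 - (max j.val k.val : ℕ)))
    (by revert k; decide) (by revert k; decide)

/-- The `A₆`-crystal `B(a₀ Λ₁ + ⋯ + a₅ Λ₆)`, where `a k` is the coefficient of the fundamental
weight `Λ_{k+1}`. -/
def crystalA₆ (a : Fin 6 → ℕ) : Crystal (CartanMatrix.A 6) :=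
  highestWeightCrystal (CartanMatrix.A 6) diag_A₆
    ((List.finRange 6).flatMap fun k => List.replicate (a k) ⟨Pi.single k 1, isMinuscule_A₆ k⟩)

/-- The Levi subdiagram of type `A₆` of the `E₇` diagram, obtained by deleting node `2`: the nodes
`1, 2, 3, 4, 5, 6` of `A₆` are the nodes `7, 6, 5, 4, 3, 1` of `E₇` (whose node `i` has index
`i - 1` in `Fin 7`). -/
def levi : Fin 6 → Fin 7 := ![6, 5, 4, 3, 2, 0]

theorem levi_spec (j k : Fin 6) :
    CartanMatrix.E₇ (levi j) (levi k) = CartanMatrix.A 6 j k := by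
  fin_cases j <;> fin_cases k <;> rfl

/-- Tuples `(m₁, m₂, m₃, m₄, m₄', m₅, m₆, m₇)` of nonnegative integers. -/
@[ext]
structure Tuple where
  m₁ : ℕ
  m₂ : ℕ
  m₃ : ℕ
  m₄ : ℕ
  m₄' : ℕ
  m₅ : ℕ
  m₆ : ℕ
  m₇ : ℕ

/-- The conditions on the tuples that index the decomposition of `B(s ϖ₇)`. -/
structure Tuple.Admissible (s : ℕ) (m : Tuple) : Prop where
  m₂_le : m.m₂ ≤ m.m₆
  m₃_le : m.m₃ ≤ m.m₅
  m₄_add_le : m.m₄ + m.m₅ ≤ m.m₇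
  min_eq : min m.m₄ m.m₄' = 0
  sum_eq : m.m₁ + m.m₂ + m.m₃ + m.m₄ + m.m₄' + m.m₅ + m.m₆ + m.m₇ = s

/-- The coefficients of `Λ₁, …, Λ₆` in the weight `μ` attached to a tuple. (For admissible tuples
no subtraction is truncated.) -/
def Tuple.weight (m : Tuple) : Fin 6 → ℕ :=
  ![m.m₁, m.m₆ - m.m₂, m.m₂, m.m₅ - m.m₃, m.m₃ + m.m₄', m.m₇ - m.m₄ - m.m₅]

end CrystalDecomp

/-!
The decomposition is read off from highest weight elements. Two facts carry the proof.

*A crystal is determined by its highest weights.* Stembridge's local axioms describe, in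
simply-laced type, how `e_i` and `e_j` interact at an element: they commute, or they span an octagon
`e_i e_j² e_i x = e_j e_i² e_j x`; dually for the lowering operators. The axioms hold trivially for
minuscule crystals and pass to tensor products (`IsStembridge.tensor`), restrictions, components and
direct sums. They make raising locally confluent, so if it also terminates, then every component has
exactly one highest weight element (`RaisingAxioms.existsUnique_highest`). They also determine a
crystal by the weights of its highest weight elements: given a weight preserving bijection between
the highest weight elements of `C` and `D`, the correspondence
`f_{i_1} ⋯ f_{i_k} u ↔ f_{i_1} ⋯ f_{i_k} v` is an isomorphism `C ≅ D`
(`HighestMatching.nonempty_iso`). That it is well defined is shown by induction on the depth: when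
an element is reached by `f_i` and by `f_j`, the square or octagon above it in `C` lies over one
in `D`.

*The highest weight elements can be listed.* In `B(ϖ₇)^{⊗ s}` the component of the top element
consists of the chains `x_1 ≥ ⋯ ≥ x_s` in the dominance order on the 56 weights of `B(ϖ₇)`
(`reach_top_iff`): chains are stable under the crystal operators, and the only chain of highest
weight is the top element. Such a chain is of highest weight for `A₆` when all its suffixes have an
`A₆`-dominant weight. Building it from the right, only eight of the 56 weights can occur
(`eq_highestLetter`), all of them comparable except for one pair. The multiplicities of these
letters are the entries of a tuple `m`, the incomparable pair gives the condition
`min m₄ m₄' = 0`, and dominance of the suffixes gives the inequalities (`exists_word_eq`). The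
weight of the chain is `μ_m`.

The decomposition is multiplicity free because `μ_m` and `s` determine `m`
(`Tuple.Admissible.eq_of_weight_eq`).
-/

namespace CrystalDecomp

namespace Crystal

variable {I J : Type} {A : Matrix I I ℤ} {A' : Matrix J J ℤ}

/-! ### Basic lemmas on crystals -/

theorem e_eq_none_iff (B : Crystal A) {i : I} {b : B.carrier} :
    B.e i b = none ↔ B.eps i b = 0 := by
  refine ⟨(B.isString_e i).eq_zero, fun h => ?_⟩
  cases hb : B.e i b with
  | none => rfl
  | some c => have := B.eps_of_e hb; omega

theorem f_eq_none_iff (B : Crystal A) {i : I} {b : B.carrier} :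
    B.f i b = none ↔ B.phi i b = 0 := by
  refine ⟨(B.isString_f i).eq_zero, fun h => ?_⟩
  cases hb : B.f i b with
  | none => rfl
  | some c => have := B.phi_of_f hb; omega

theorem exists_e (B : Crystal A) {i : I} {b : B.carrier} (h : 0 < B.eps i b) :
    ∃ c, B.e i b = some c := by
  rw [← Option.ne_none_iff_exists', ne_eq, e_eq_none_iff]
  omega

theorem exists_f (B : Crystal A) {i : I} {b : B.carrier} (h : 0 < B.phi i b) :
    ∃ c, B.f i b = some c := by
  rw [← Option.ne_none_iff_exists', ne_eq, f_eq_none_iff]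
  omega

theorem wt_e (B : Crystal A) {i : I} {b c : B.carrier} (h : B.e i b = some c) (j : I) :
    B.wt c j = B.wt b j + A j i := by
  have := B.wt_f i c b ((B.f_eq_some_iff i _ _).2 h) j
  omega

/-- The dual crystal, in which the roles of `e` and `f` are interchanged. -/
def dual (B : Crystal A) : Crystal A where
  carrier := B.carrier
  e := B.f
  f := B.e
  wt b j := -B.wt b j
  eps := B.phi
  phi := B.eps
  isString_e := B.isString_f
  isString_f := B.isString_e
  phi_eq i b := by have := B.phi_eq i b; omega
  f_eq_some_iff i b c := (B.f_eq_some_iff i c b).symm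
  wt_f i b c h j := by have := B.wt_e h j; omega

theorem tensor_e_left {B C : Crystal A} {i : I} {b b' : B.carrier} {c : C.carrier}
    (h : C.phi i c < B.eps i b) (hb : B.e i b = some b') :
    (B.tensor C).e i (b, c) = some (b', c) := by
  simp [tensor, h, hb]

theorem tensor_e_right {B C : Crystal A} {i : I} {b : B.carrier} {c c' : C.carrier}
    (h : B.eps i b ≤ C.phi i c) (hc : C.e i c = some c') :
    (B.tensor C).e i (b, c) = some (b, c') := by
  simp [tensor, h, hc]

theorem tensor_e_cases {B C : Crystal A} {i : I} {b : B.carrier} {c : C.carrier}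
    {y : (B.tensor C).carrier} (h : (B.tensor C).e i (b, c) = some y) :
    (C.phi i c < B.eps i b ∧ ∃ b', B.e i b = some b' ∧ y = (b', c)) ∨
      (B.eps i b ≤ C.phi i c ∧ ∃ c', C.e i c = some c' ∧ y = (b, c')) := by
  simp only [tensor] at h
  split_ifs at h with h1
  · obtain ⟨b', hb, rfl⟩ := Option.map_eq_some_iff.1 h
    exact .inl ⟨h1, b', hb, rfl⟩
  · obtain ⟨c', hc, rfl⟩ := Option.map_eq_some_iff.1 h
    exact .inr ⟨not_lt.1 h1, c', hc, rfl⟩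

theorem tensor_f_cases {B C : Crystal A} {i : I} {b : B.carrier} {c : C.carrier}
    {y : (B.tensor C).carrier} (h : (B.tensor C).f i (b, c) = some y) :
    (B.eps i b < C.phi i c ∧ ∃ c', C.f i c = some c' ∧ y = (b, c')) ∨
      (C.phi i c ≤ B.eps i b ∧ ∃ b', B.f i b = some b' ∧ y = (b', c)) := by
  simp only [tensor] at h
  split_ifs at h with h1
  · obtain ⟨c', hc, rfl⟩ := Option.map_eq_some_iff.1 h
    exact .inl ⟨h1, c', hc, rfl⟩
  · obtain ⟨b', hb, rfl⟩ := Option.map_eq_some_iff.1 h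
    exact .inr ⟨not_lt.1 h1, b', hb, rfl⟩

theorem tensor_eps (B C : Crystal A) (i : I) (b : B.carrier) (c : C.carrier) :
    (B.tensor C).eps i (b, c) = C.eps i c + (B.eps i b - C.phi i c) := rfl

/-! ### Stembridge's local axioms -/

/-- Stembridge's local axioms for the raising operators of a simply-laced crystal. -/
structure RaisingAxioms (B : Crystal A) : Prop where
  /-- Raising along `i` changes `ε_j` by `0`, or by `1` when `i` and `j` are adjacent. -/
  adj : ∀ {i j}, i ≠ j → ∀ {x y}, B.e i x = some y →
    B.eps j y = B.eps j x ∨ A j i = -1 ∧ B.eps j y = B.eps j x + 1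
  /-- If `e_i` does not change `ε_j`, then `e_i` and `e_j` commute at `x`. -/
  square : ∀ {i j}, i ≠ j → ∀ {x y z}, B.e i x = some y → B.e j x = some z →
    B.eps j y = B.eps j x → (A j i = -1 → B.eps i z = B.eps i x + 1) ∧
      ∃ w, B.e j y = some w ∧ B.e i z = some w
  /-- If `e_i` increases `ε_j` and `e_j` increases `ε_i`, then `e_i e_j² e_i x = e_j e_i² e_j x`. -/
  octagon : ∀ {i j}, i ≠ j → ∀ {x y z}, B.e i x = some y → B.e j x = some z →
    B.eps j y = B.eps j x + 1 → B.eps i z = B.eps i x + 1 →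
      ∃ y₁ y₂ z₁ z₂ w, B.e j y = some y₁ ∧ B.e j y₁ = some y₂ ∧ B.e i y₂ = some w ∧
        B.e i z = some z₁ ∧ B.e i z₁ = some z₂ ∧ B.e j z₂ = some w ∧
        B.eps i w + 1 = B.eps i x ∧ B.eps j w + 1 = B.eps j x

/-- Stembridge's local axioms: those for the raising operators and, dually, those for the lowering
operators. -/
structure IsStembridge (B : Crystal A) : Prop where
  raising : B.RaisingAxioms
  lowering : B.dual.RaisingAxioms

/-- Symmetric generalized Cartan matrices with off-diagonal entries `0` and `-1`. -/
structure IsSimplyLaced (A : Matrix I I ℤ) : Prop where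
  diag : ∀ i, A i i = 2
  symm : ∀ i j, A i j = A j i
  off_diag : ∀ i j, i ≠ j → A i j = 0 ∨ A i j = -1

/-- In an `i`-string, once `ε_j` has increased, the next step up commutes with `e_j`. -/
theorem IsStembridge.eps_eq_of_step {B : Crystal A} (hB : B.IsStembridge) (hA : IsSimplyLaced A)
    {i j : I} (hij : i ≠ j) {x y z : B.carrier} (hy : B.e i x = some y)
    (hyj : B.eps j y = B.eps j x + 1) (hz : B.e j y = some z) : B.eps i z = B.eps i y := by
  have hA1 : A j i = -1 := by
    rcases hB.raising.adj hij hy with h | h <;> omega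
  have hA2 : A i j = -1 := by rw [hA.symm]; exact hA1
  rcases hB.raising.adj hij.symm hz with h | ⟨-, h⟩
  · exact h
  have w1 := B.wt_e hy i
  have w2 := B.wt_e hy j
  have w3 := B.wt_e hz i
  have w4 := B.wt_e hz j
  have hd := hA.diag
  have p1 := B.phi_eq i x
  have p2 := B.phi_eq j x
  have p3 := B.phi_eq i y
  have p4 := B.phi_eq j y
  have p5 := B.phi_eq i z
  have p6 := B.phi_eq j z
  have e1 := B.eps_of_e hy
  have e2 := B.eps_of_e hz
  rw [hd] at w1 w4
  obtain ⟨v, hv⟩ := B.exists_f (i := i) (b := z) (by omega)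
  have := hB.lowering.square hij.symm (x := z) (y := y) (z := v)
    ((B.f_eq_some_iff _ _ _).2 hz) hv (by change B.phi i y = B.phi i z; omega)
  obtain ⟨h1, w, hw1, hw2⟩ := this
  have h1 : B.phi j v = B.phi j z + 1 := h1 hA2
  have hw1 : B.f i y = some w := hw1
  have hw2 : B.f j v = some w := hw2
  rw [(B.f_eq_some_iff _ _ _).2 hy] at hw1
  obtain rfl := Option.some.inj hw1
  have := B.phi_of_f hw2
  omega

/-- The possible changes of `ε_j` and `φ_j` along an arrow of another colour. -/
theorem RaisingAxioms.adj_cases {B : Crystal A} (hB : B.RaisingAxioms) (hA : IsSimplyLaced A)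
    {i j : I} (hij : i ≠ j) {x y : B.carrier} (hy : B.e i x = some y) :
    (A j i = 0 ∧ B.eps j y = B.eps j x ∧ B.phi j y = B.phi j x) ∨
      (A j i = -1 ∧ B.eps j y = B.eps j x ∧ B.phi j y + 1 = B.phi j x) ∨
      (A j i = -1 ∧ B.eps j y = B.eps j x + 1 ∧ B.phi j y = B.phi j x) := by
  have h1 := hB.adj hij hy
  have h2 := hA.off_diag j i hij.symm
  have h3 := B.wt_e hy j
  have h4 := B.phi_eq j x
  have h5 := B.phi_eq j y
  omega

/-- The octagon in `B ⊗ C` at an element at which `e_i` and `e_j` act on different factors. -/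
theorem octagon_tensor_mixed {B C : Crystal A} (hA : IsSimplyLaced A) (hB : B.IsStembridge)
    (hC : C.IsStembridge) {i j : I} (hij : i ≠ j) {b b' : B.carrier} {c c' : C.carrier}
    (hb : B.e i b = some b') (hc : C.e j c = some c') (hi : C.phi i c < B.eps i b)
    (hj : B.eps j b = C.phi j c) (hb' : B.eps j b' = B.eps j b + 1) :
    ∃ y₁ y₂ z₁ z₂ w, (B.tensor C).e j (b', c) = some y₁ ∧ (B.tensor C).e j y₁ = some y₂ ∧
      (B.tensor C).e i y₂ = some w ∧ (B.tensor C).e i (b, c') = some z₁ ∧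
      (B.tensor C).e i z₁ = some z₂ ∧ (B.tensor C).e j z₂ = some w ∧
      (B.tensor C).eps i w + 1 = (B.tensor C).eps i (b, c) ∧
      (B.tensor C).eps j w + 1 = (B.tensor C).eps j (b, c) := by
  have hAji : A j i = -1 := by
    rcases hB.raising.adj hij hb with h | h <;> omega
  have hAij : A i j = -1 := by rw [hA.symm]; exact hAji
  obtain ⟨b₁, hb₁⟩ := B.exists_e (i := j) (b := b') (by omega)
  have hb₁i := hB.eps_eq_of_step hA hij hb hb' hb₁
  have n1 := B.eps_of_e hb
  have n2 := C.eps_of_e hc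
  have n3 := C.phi_of_e hc
  have n4 := B.eps_of_e hb₁
  have n5 := hC.raising.adj_cases hA hij.symm hc
  have hy₁ : (B.tensor C).e j (b', c) = some (b₁, c) := tensor_e_left (by omega) hb₁
  have hy₂ : (B.tensor C).e j (b₁, c) = some (b₁, c') := tensor_e_right (by omega) hc
  have hz₁ : (B.tensor C).e i (b, c') = some (b', c') := tensor_e_left (by omega) hb
  by_cases hcase : C.phi i c' < B.eps i b'
  · -- Both remaining raisings act on the left factor, where `e_i` and `e_j` commute.
    obtain ⟨b₂, hb₂⟩ := B.exists_e (i := i) (b := b') (by omega)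
    obtain ⟨h1, w, hw1, hw2⟩ := hB.raising.square hij.symm hb₁ hb₂ hb₁i
    have h1 := h1 hAij
    have n6 := B.eps_of_e hb₂
    have n7 := B.eps_of_e hw1
    have n8 := B.eps_of_e hw2
    refine ⟨_, _, (b', c'), (b₂, c'), (w, c'), hy₁, hy₂, tensor_e_left (by omega) hw1, hz₁,
      tensor_e_left (by omega) hb₂, tensor_e_left (by omega) hw2, ?_, ?_⟩ <;>
    · simp only [tensor_eps]
      omega
  · -- The string lengths for `i` balance, and both remaining raisings along `i` act on `c'`.
    have n9 : C.eps i c' = C.eps i c + 1 := by omega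
    obtain ⟨c₁, hc₁⟩ := C.exists_e (i := i) (b := c') (by omega)
    have n10 := hC.eps_eq_of_step hA hij.symm hc n9 hc₁
    have n11 := hC.raising.adj_cases hA hij hc₁
    have n12 := C.eps_of_e hc₁
    have n13 := C.phi_of_e hc₁
    refine ⟨_, _, (b', c'), (b', c₁), (b₁, c₁), hy₁, hy₂, tensor_e_right (by omega) hc₁, hz₁,
      tensor_e_right (by omega) hc₁, tensor_e_left (by omega) hb₁, ?_, ?_⟩ <;>
    · simp only [tensor_eps]
      omega

/-- The octagon in `B ⊗ C` at an element at which `e_i` and `e_j` both act on the right factor and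
span a square there, while the string lengths for `j` balance. -/
theorem octagon_tensor_balanced {B C : Crystal A} (hA : IsSimplyLaced A) (hB : B.IsStembridge)
    (hC : C.IsStembridge) {i j : I} (hij : i ≠ j) {b : B.carrier} {c c' c'' : C.carrier}
    (hc : C.e i c = some c') (hc' : C.e j c = some c'') (hi : B.eps i b ≤ C.phi i c)
    (hj : B.eps j b = C.phi j c) (hcc : C.eps j c' = C.eps j c) (hA1 : A j i = -1) :
    ∃ y₁ y₂ z₁ z₂ w, (B.tensor C).e j (b, c') = some y₁ ∧ (B.tensor C).e j y₁ = some y₂ ∧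
      (B.tensor C).e i y₂ = some w ∧ (B.tensor C).e i (b, c'') = some z₁ ∧
      (B.tensor C).e i z₁ = some z₂ ∧ (B.tensor C).e j z₂ = some w ∧
      (B.tensor C).eps i w + 1 = (B.tensor C).eps i (b, c) ∧
      (B.tensor C).eps j w + 1 = (B.tensor C).eps j (b, c) := by
  obtain ⟨h, w, hw1, hw2⟩ := hC.raising.square hij hc hc' hcc
  have h := h hA1
  have n1 := hC.raising.adj_cases hA hij hc
  have n2 := hC.raising.adj_cases hA hij.symm hc'
  have n3 := C.phi_of_e hc
  have n4 := C.phi_of_e hc'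
  have n5 := C.phi_of_e hw1
  have n6 := C.phi_of_e hw2
  have n7 := C.eps_of_e hc
  have n8 := C.eps_of_e hc'
  have n9 := C.eps_of_e hw1
  have n10 := C.eps_of_e hw2
  obtain ⟨b', hb⟩ := B.exists_e (i := j) (b := b) (by omega)
  obtain ⟨w', hw'⟩ := C.exists_e (i := i) (b := w) (by omega)
  have n11 := hC.eps_eq_of_step hA hij.symm hw1 (by omega) hw'
  have n12 := hC.raising.adj_cases hA hij hw'
  have n13 := B.eps_of_e hb
  have n14 := hB.raising.adj_cases hA hij.symm hb
  have n15 := C.phi_of_e hw'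
  have n16 := C.eps_of_e hw'
  exact ⟨(b', c'), (b', w), (b, w), (b, w'), (b', w'), tensor_e_left (by omega) hb,
    tensor_e_right (by omega) hw1, tensor_e_right (by omega) hw', tensor_e_right (by omega) hw2,
    tensor_e_right (by omega) hw', tensor_e_left (by omega) hb,
    by simp only [tensor_eps]; omega, by simp only [tensor_eps]; omega⟩

theorem IsStembridge.raising_tensor {B C : Crystal A} (hA : IsSimplyLaced A)
    (hB : B.IsStembridge) (hC : C.IsStembridge) : (B.tensor C).RaisingAxioms := by
  refine ⟨?_, ?_, ?_⟩
  · rintro i j hij ⟨b, c⟩ y h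
    rcases tensor_e_cases h with ⟨h1, b', hb, rfl⟩ | ⟨h1, c', hc, rfl⟩
    · have := hB.raising.adj_cases hA hij hb
      simp only [tensor_eps]
      omega
    · have := hC.raising.adj_cases hA hij hc
      simp only [tensor_eps]
      omega
  · rintro i j hij ⟨b, c⟩ y z hy hz hyz
    have hs := hA.symm i j
    rcases tensor_e_cases hy with ⟨h1, b', hb, rfl⟩ | ⟨h1, c', hc, rfl⟩ <;>
    rcases tensor_e_cases hz with ⟨h2, b'', hb', rfl⟩ | ⟨h2, c'', hc', rfl⟩ <;>
    simp only [tensor_eps] at hyz ⊢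
    · obtain ⟨h3, w, hw1, hw2⟩ := hB.raising.square hij hb hb' (by
        have := hB.raising.adj_cases hA hij hb
        omega)
      have n1 := hB.raising.adj_cases hA hij hb
      have n2 := hB.raising.adj_cases hA hij.symm hb'
      exact ⟨fun h => by have := h3 h; omega, (w, c), tensor_e_left (by omega) hw1,
        tensor_e_left (by omega) hw2⟩
    · have n1 := hB.raising.adj_cases hA hij hb
      have n2 := hC.raising.adj_cases hA hij.symm hc'
      have n3 := C.phi_of_e hc'
      have n4 := B.eps_of_e hb
      exact ⟨fun h => by omega, (b', c''), tensor_e_right (by omega) hc',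
        tensor_e_left (by omega) hb⟩
    · have n1 := hC.raising.adj_cases hA hij hc
      have n2 := hB.raising.adj_cases hA hij.symm hb'
      have n3 := C.phi_of_e hc
      have n4 := B.eps_of_e hb'
      exact ⟨fun h => by omega, (b'', c'), tensor_e_left (by omega) hb',
        tensor_e_right (by omega) hc⟩
    · have n1 := hC.raising.adj_cases hA hij hc
      have n2 := hC.raising.adj_cases hA hij.symm hc'
      have n3 := C.phi_of_e hc
      have n4 := C.phi_of_e hc'
      obtain ⟨h3, w, hw1, hw2⟩ := hC.raising.square hij hc hc' (by omega)
      exact ⟨fun h => by have := h3 h; omega, (b, w), tensor_e_right (by omega) hw1,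
        tensor_e_right (by omega) hw2⟩
  · rintro i j hij ⟨b, c⟩ y z hy hz hyz hzy
    have hs := hA.symm i j
    rcases tensor_e_cases hy with ⟨h1, b', hb, rfl⟩ | ⟨h1, c', hc, rfl⟩ <;>
    rcases tensor_e_cases hz with ⟨h2, b'', hb', rfl⟩ | ⟨h2, c'', hc', rfl⟩ <;>
    simp only [tensor_eps] at hyz hzy ⊢
    · have n1 := hB.raising.adj_cases hA hij hb
      have n2 := hB.raising.adj_cases hA hij.symm hb'
      obtain ⟨y₁, y₂, z₁, z₂, w, a1, a2, a3, a4, a5, a6, a7, a8⟩ :=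
        hB.raising.octagon hij hb hb' (by omega) (by omega)
      have m1 := B.eps_of_e hb
      have m2 := B.eps_of_e hb'
      have m3 := B.eps_of_e a1
      have m4 := B.eps_of_e a2
      have m5 := B.eps_of_e a3
      have m6 := B.eps_of_e a4
      have m7 := B.eps_of_e a5
      have m8 := B.eps_of_e a6
      exact ⟨(y₁, c), (y₂, c), (z₁, c), (z₂, c), (w, c), tensor_e_left (by omega) a1,
        tensor_e_left (by omega) a2, tensor_e_left (by omega) a3, tensor_e_left (by omega) a4,
        tensor_e_left (by omega) a5, tensor_e_left (by omega) a6,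
        by simp only [tensor_eps]; omega, by simp only [tensor_eps]; omega⟩
    · have n1 := hB.raising.adj_cases hA hij hb
      exact octagon_tensor_mixed hA hB hC hij hb hc' h1 (by omega) (by omega)
    · have n1 := hB.raising.adj_cases hA hij.symm hb'
      obtain ⟨y₁, y₂, z₁, z₂, w, a1, a2, a3, a4, a5, a6, a7, a8⟩ :=
        octagon_tensor_mixed hA hB hC hij.symm hb' hc h2 (by omega) (by omega)
      exact ⟨z₁, z₂, y₁, y₂, w, a4, a5, a6, a1, a2, a3, a8, a7⟩
    · have n1 := hC.raising.adj_cases hA hij hc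
      have n2 := hC.raising.adj_cases hA hij.symm hc'
      have m1 := C.phi_of_e hc
      have m2 := C.phi_of_e hc'
      by_cases k1 : C.eps j c' = C.eps j c
      · exact octagon_tensor_balanced hA hB hC hij hc hc' h1 (by omega) k1 (by omega)
      by_cases k2 : C.eps i c'' = C.eps i c
      · obtain ⟨y₁, y₂, z₁, z₂, w, a1, a2, a3, a4, a5, a6, a7, a8⟩ :=
          octagon_tensor_balanced hA hB hC hij.symm hc' hc h2 (by omega) k2 (by omega)
        exact ⟨z₁, z₂, y₁, y₂, w, a4, a5, a6, a1, a2, a3, a8, a7⟩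
      obtain ⟨y₁, y₂, z₁, z₂, w, a1, a2, a3, a4, a5, a6, a7, a8⟩ :=
        hC.raising.octagon hij hc hc' (by omega) (by omega)
      have m3 := C.phi_of_e a1
      have m4 := C.phi_of_e a2
      have m5 := C.phi_of_e a3
      have m6 := C.phi_of_e a4
      have m7 := C.phi_of_e a5
      have m8 := C.phi_of_e a6
      have k3 := hC.raising.adj_cases hA hij.symm a2
      have k4 := hC.raising.adj_cases hA hij.symm a1
      have k5 := hC.raising.adj_cases hA hij a4
      have k6 := hC.raising.adj_cases hA hij a5
      have l1 := C.eps_of_e hc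
      have l2 := C.eps_of_e hc'
      have l3 := C.eps_of_e a3
      have l4 := C.eps_of_e a6
      exact ⟨(b, y₁), (b, y₂), (b, z₁), (b, z₂), (b, w), tensor_e_right (by omega) a1,
        tensor_e_right (by omega) a2, tensor_e_right (by omega) a3, tensor_e_right (by omega) a4,
        tensor_e_right (by omega) a5, tensor_e_right (by omega) a6,
        by simp only [tensor_eps]; omega, by simp only [tensor_eps]; omega⟩

/-- Stembridge's axioms for the raising operators pass to a crystal embedded in another one as a
union of components. -/
theorem RaisingAxioms.of_embedding {B C : Crystal A} (hC : C.RaisingAxioms)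
    (g : B.carrier → C.carrier) (hg : Function.Injective g)
    (he : ∀ i b, C.e i (g b) = (B.e i b).map g) (heps : ∀ i b, C.eps i (g b) = B.eps i b) :
    B.RaisingAxioms := by
  have fwd : ∀ {i x y}, B.e i x = some y → C.e i (g x) = some (g y) := by
    intro i x y h
    rw [he, h, Option.map_some]
  have bwd : ∀ {i x y}, C.e i (g x) = some y → ∃ z, B.e i x = some z ∧ g z = y := by
    intro i x y h
    rw [he] at h
    exact Option.map_eq_some_iff.1 h
  refine ⟨?_, ?_, ?_⟩
  · intro i j hij x y h
    simpa only [heps] using hC.adj hij (fwd h)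
  · intro i j hij x y z hy hz h
    obtain ⟨h1, w, h2, h3⟩ := hC.square hij (fwd hy) (fwd hz) (by simpa only [heps] using h)
    obtain ⟨w, k2, rfl⟩ := bwd h2
    obtain ⟨w', k3, h4⟩ := bwd h3
    obtain rfl := hg h4
    exact ⟨by simpa only [heps] using h1, w', k2, k3⟩
  · intro i j hij x y z hy hz h h'
    obtain ⟨y₁, y₂, z₁, z₂, w, a1, a2, a3, a4, a5, a6, a7, a8⟩ :=
      hC.octagon hij (fwd hy) (fwd hz) (by simpa only [heps] using h)
        (by simpa only [heps] using h')
    obtain ⟨y₁, b1, rfl⟩ := bwd a1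
    obtain ⟨y₂, b2, rfl⟩ := bwd a2
    obtain ⟨w, b3, rfl⟩ := bwd a3
    obtain ⟨z₁, b4, rfl⟩ := bwd a4
    obtain ⟨z₂, b5, rfl⟩ := bwd a5
    obtain ⟨w', b6, hw⟩ := bwd a6
    obtain rfl := hg hw
    simp only [heps] at a7 a8
    exact ⟨y₁, y₂, z₁, z₂, w', b1, b2, b3, b4, b5, b6, a7, a8⟩

theorem raisingAxioms_directSum {K : Type} {B : K → Crystal A} (hB : ∀ k, (B k).RaisingAxioms) :
    (directSum B).RaisingAxioms := by
  have fwd : ∀ {i k} {x y : (B k).carrier}, (B k).e i x = some y →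
      (directSum B).e i ⟨k, x⟩ = some ⟨k, y⟩ := by
    intro i k x y h
    simp [directSum, h]
  have bwd : ∀ {i k} {x : (B k).carrier} {y}, (directSum B).e i ⟨k, x⟩ = some y →
      ∃ z, (B k).e i x = some z ∧ y = ⟨k, z⟩ := by
    intro i k x y h
    obtain ⟨z, hz, rfl⟩ := Option.map_eq_some_iff.1 h
    exact ⟨z, hz, rfl⟩
  refine ⟨?_, ?_, ?_⟩
  · rintro i j hij ⟨k, x⟩ y h
    obtain ⟨y, hy, rfl⟩ := bwd h
    exact (hB k).adj hij hy
  · rintro i j hij ⟨k, x⟩ y z hy hz h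
    obtain ⟨y, hy', rfl⟩ := bwd hy
    obtain ⟨z, hz', rfl⟩ := bwd hz
    obtain ⟨h1, w, h2, h3⟩ := (hB k).square hij hy' hz' h
    exact ⟨h1, _, fwd h2, fwd h3⟩
  · rintro i j hij ⟨k, x⟩ y z hy hz h h'
    obtain ⟨y, hy', rfl⟩ := bwd hy
    obtain ⟨z, hz', rfl⟩ := bwd hz
    obtain ⟨y₁, y₂, z₁, z₂, w, a1, a2, a3, a4, a5, a6, a7, a8⟩ := (hB k).octagon hij hy' hz' h h'
    exact ⟨_, _, _, _, _, fwd a1, fwd a2, fwd a3, fwd a4, fwd a5, fwd a6, a7, a8⟩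

theorem RaisingAxioms.restrict {B : Crystal A} (hB : B.RaisingAxioms) {ι : J → I}
    (hι : ∀ j k, A (ι j) (ι k) = A' j k) (hinj : Function.Injective ι) :
    (B.restrict ι hι).RaisingAxioms := by
  refine ⟨?_, ?_, ?_⟩
  · intro i j hij x y h
    rw [← hι]
    exact hB.adj (hinj.ne hij) h
  · intro i j hij x y z hy hz h
    rw [← hι]
    exact hB.square (hinj.ne hij) hy hz h
  · intro i j hij x y z hy hz h h'
    exact hB.octagon (hinj.ne hij) hy hz h h'

theorem IsStembridge.dual {B : Crystal A} (hB : B.IsStembridge) : B.dual.IsStembridge :=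
  ⟨hB.lowering, ⟨hB.raising.adj, hB.raising.square, hB.raising.octagon⟩⟩

/-- Tensor products inherit Stembridge's axioms. For the lowering operators this is a matter of
duality, the dual of `B ⊗ C` being isomorphic to the tensor product of the duals in the opposite
order. -/
theorem IsStembridge.tensor {B C : Crystal A} (hA : IsSimplyLaced A) (hB : B.IsStembridge)
    (hC : C.IsStembridge) : (B.tensor C).IsStembridge := by
  refine ⟨hB.raising_tensor hA hC, ?_⟩
  refine (hC.dual.raising_tensor hA hB.dual).of_embedding (B := (B.tensor C).dual)
    (fun x => (x.2, x.1)) (fun x y h => ?_) (fun i x => ?_) (fun i x => rfl)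
  · exact Prod.ext (congrArg Prod.snd h) (congrArg Prod.fst h)
  · simp only [Crystal.dual, Crystal.tensor]
    split_ifs <;> simp [Function.comp_def]

theorem IsStembridge.restrict {B : Crystal A} (hB : B.IsStembridge) {ι : J → I}
    (hι : ∀ j k, A (ι j) (ι k) = A' j k) (hinj : Function.Injective ι) :
    (B.restrict ι hι).IsStembridge :=
  ⟨hB.raising.restrict hι hinj,
    let h := hB.lowering.restrict hι hinj
    ⟨h.adj, h.square, h.octagon⟩⟩

theorem IsStembridge.component {B : Crystal A} (hB : B.IsStembridge) (b : B.carrier) :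
    (B.component b).IsStembridge := by
  have key : ∀ (o : Option B.carrier) (h : ∀ a, o = some a → B.Reach b a),
      o = (o.pmap (fun c hc => (⟨c, hc⟩ : {c // B.Reach b c})) h).map Subtype.val := by
    rintro (_ | o) h <;> simp
  exact ⟨hB.raising.of_embedding (B := B.component b) Subtype.val Subtype.val_injective
      (fun i x => key _ _) (fun i x => rfl),
    hB.lowering.of_embedding (B := (B.component b).dual) Subtype.val Subtype.val_injective
      (fun i x => key _ _) (fun i x => rfl)⟩

theorem isStembridge_directSum {K : Type} {B : K → Crystal A} (hB : ∀ k, (B k).IsStembridge) :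
    (directSum B).IsStembridge := by
  refine ⟨raisingAxioms_directSum fun k => (hB k).raising, ?_⟩
  have h := raisingAxioms_directSum fun k => (hB k).lowering
  exact ⟨h.adj, h.square, h.octagon⟩

theorem RaisingAxioms.of_e_eq_none {B : Crystal A} (h : ∀ i x, B.e i x = none) :
    B.RaisingAxioms := by
  constructor
  · intro i j _ x y hy
    simp [h] at hy
  · intro i j _ x y z hy
    simp [h] at hy
  · intro i j _ x y z hy
    simp [h] at hy

theorem isStembridge_trivial : (trivial A).IsStembridge :=
  ⟨.of_e_eq_none fun _ _ => rfl, .of_e_eq_none fun _ _ => rfl⟩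

end Crystal

open Crystal

variable {I : Type} {A : Matrix I I ℤ}

/-! ### Stembridge's axioms for tensor products of minuscule crystals -/

theorem minuscule_e_iff {hA : ∀ i, A i i = 2} {l : I → ℤ} {hl : IsMinuscule A l} {i : I}
    {x y : (minusculeCrystal A hA l hl).carrier} :
    (minusculeCrystal A hA l hl).e i x = some y ↔
      x.1 i = -1 ∧ ∀ j, y.1 j = x.1 j + A j i := by
  simp only [minusculeCrystal]
  split_ifs with h
  · constructor
    · intro h1
      obtain rfl := Option.some.inj h1
      exact ⟨h, fun _ => rfl⟩
    · intro h1
      exact congrArg some (Subtype.ext (funext fun j => (h1.2 j).symm))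
  · simp [h]

theorem minuscule_f_iff {hA : ∀ i, A i i = 2} {l : I → ℤ} {hl : IsMinuscule A l} {i : I}
    {x y : (minusculeCrystal A hA l hl).carrier} :
    (minusculeCrystal A hA l hl).f i x = some y ↔
      x.1 i = 1 ∧ ∀ j, y.1 j = x.1 j - A j i := by
  simp only [minusculeCrystal]
  split_ifs with h
  · constructor
    · intro h1
      obtain rfl := Option.some.inj h1
      exact ⟨h, fun _ => rfl⟩
    · intro h1
      exact congrArg some (Subtype.ext (funext fun j => (h1.2 j).symm))
  · simp [h]

theorem minuscule_bounds {hA : ∀ i, A i i = 2} {l : I → ℤ} {hl : IsMinuscule A l}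
    (x : (minusculeCrystal A hA l hl).carrier) (i : I) : -1 ≤ x.1 i ∧ x.1 i ≤ 1 :=
  hl.bounds x.1 x.2 i

/-- In a minuscule crystal `e_i` and `e_j` are never both defined for adjacent `i` and `j`, so that
only commuting squares occur. -/
theorem isStembridge_minusculeCrystal (hA : IsSimplyLaced A) (l : I → ℤ) (hl : IsMinuscule A l) :
    (minusculeCrystal A hA.diag l hl).IsStembridge := by
  have eps : ∀ i x, (minusculeCrystal A hA.diag l hl).eps i x = (-x.1 i).toNat := fun _ _ => rfl
  have deps : ∀ i (x : (minusculeCrystal A hA.diag l hl).carrier),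
      (minusculeCrystal A hA.diag l hl).dual.eps i x = (x.1 i).toNat := fun _ _ => rfl
  have fi : ∀ {i} {x y : (minusculeCrystal A hA.diag l hl).carrier},
      (minusculeCrystal A hA.diag l hl).f i x = some y ↔
        x.1 i = 1 ∧ ∀ j, y.1 j = x.1 j - A j i := minuscule_f_iff
  have bd := minuscule_bounds (hA := hA.diag) (hl := hl)
  refine ⟨⟨?_, ?_, ?_⟩, ⟨?_, ?_, ?_⟩⟩
  · intro i j hij x y h
    obtain ⟨h1, h2⟩ := minuscule_e_iff.1 h
    have h2 := h2 j
    have h3 := bd x j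
    have h4 := bd y j
    have h5 := hA.off_diag j i hij.symm
    rw [eps, eps]
    omega
  · intro i j hij x y z hy hz h
    obtain ⟨h1, h2⟩ := minuscule_e_iff.1 hy
    obtain ⟨h3, h4⟩ := minuscule_e_iff.1 hz
    have h5 := bd y j
    have h6 := hA.off_diag j i hij.symm
    have h7 := h2 j
    have h8 : A j i = 0 := by omega
    obtain ⟨w, hw⟩ := (minusculeCrystal A hA.diag l hl).exists_e (i := j) (b := y)
      (by rw [eps]; omega)
    refine ⟨by omega, w, hw, minuscule_e_iff.2 ⟨?_, fun k => ?_⟩⟩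
    · rw [h4, hA.symm, h8, h1]; rfl
    · have := (minuscule_e_iff.1 hw).2 k
      have := h2 k
      have := h4 k
      omega
  · intro i j hij x y z hy hz h
    obtain ⟨h1, h2⟩ := minuscule_e_iff.1 hy
    obtain ⟨h3, h4⟩ := minuscule_e_iff.1 hz
    have h5 := bd y j
    rw [eps, eps] at h
    omega
  · intro i j hij x y h
    obtain ⟨h1, h2⟩ := fi.1 h
    have h2 := h2 j
    have h3 := bd x j
    have h4 := bd y j
    have h5 := hA.off_diag j i hij.symm
    have h6 := deps j x
    have h7 := deps j y
    omega
  · intro i j hij x y z hy hz h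
    obtain ⟨h1, h2⟩ := fi.1 hy
    obtain ⟨h3, h4⟩ := fi.1 hz
    have h5 := bd y j
    have h6 := hA.off_diag j i hij.symm
    have h7 := h2 j
    have h8 : A j i = 0 := by omega
    obtain ⟨w, hw⟩ := (minusculeCrystal A hA.diag l hl).exists_f (i := j) (b := y)
      (by have : (minusculeCrystal A hA.diag l hl).phi j y = _ := deps j y; omega)
    refine ⟨by omega, w, hw, minuscule_f_iff.2 ⟨?_, fun k => ?_⟩⟩
    · rw [h4, hA.symm, h8, h1]; rfl
    · have := (fi.1 hw).2 k
      have := h2 k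
      have := h4 k
      omega
  · intro i j hij x y z hy hz h
    obtain ⟨h1, h2⟩ := fi.1 hy
    obtain ⟨h3, h4⟩ := fi.1 hz
    have h5 := bd y j
    have h6 := deps j x
    have h7 := deps j y
    omega

theorem isStembridge_minusculeTensor (hA : IsSimplyLaced A) :
    ∀ L, (minusculeTensor A hA.diag L).IsStembridge
  | [] => isStembridge_trivial
  | l :: L => (isStembridge_minusculeCrystal hA l.1 l.2).tensor hA
      (isStembridge_minusculeTensor hA L)

namespace Crystal

variable {I J : Type} {A : Matrix I I ℤ}

/-! ### Highest weight elements -/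

/-- Highest weight elements: those annihilated by all raising operators. -/
def IsHighest (B : Crystal A) (b : B.carrier) : Prop := ∀ i, B.e i b = none

theorem isHighest_iff {B : Crystal A} {b : B.carrier} :
    B.IsHighest b ↔ ∀ i, B.eps i b = 0 := by
  simp only [IsHighest, e_eq_none_iff]

/-- The function `d` of the weight strictly decreases under the raising operators. It guarantees
that raising terminates. -/
def IsGraded (B : Crystal A) (d : (I → ℤ) → ℕ) : Prop :=
  ∀ ⦃i x y⦄, B.e i x = some y → d (B.wt y) < d (B.wt x)

/-- `y` is obtained from `x` by raising operators. -/
def Raises (B : Crystal A) : B.carrier → B.carrier → Prop :=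
  Relation.ReflTransGen fun x y => ∃ i, B.e i x = some y

theorem Raises.single {B : Crystal A} {i : I} {x y : B.carrier} (h : B.e i x = some y) :
    B.Raises x y := Relation.ReflTransGen.single ⟨i, h⟩

theorem Raises.eq_of_isHighest {B : Crystal A} {x y : B.carrier} (h : B.Raises x y)
    (hx : B.IsHighest x) : x = y := by
  rcases Relation.ReflTransGen.cases_head h with rfl | ⟨z, ⟨i, hz⟩, -⟩
  · rfl
  · simp [hx i] at hz

/-- Stembridge's axioms make raising locally confluent. -/
theorem RaisingAxioms.confluent {B : Crystal A} (hB : B.RaisingAxioms) {i j : I}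
    {x y z : B.carrier} (hy : B.e i x = some y) (hz : B.e j x = some z) :
    ∃ w, B.Raises y w ∧ B.Raises z w := by
  by_cases hij : i = j
  · subst hij
    obtain rfl := Option.some.inj (hy.symm.trans hz)
    exact ⟨y, .refl, .refl⟩
  rcases hB.adj hij hy with h1 | ⟨-, h1⟩
  · obtain ⟨-, w, h2, h3⟩ := hB.square hij hy hz h1
    exact ⟨w, .single h2, .single h3⟩
  rcases hB.adj (Ne.symm hij) hz with h2 | ⟨-, h2⟩
  · obtain ⟨-, w, h2, h3⟩ := hB.square (Ne.symm hij) hz hy h2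
    exact ⟨w, .single h3, .single h2⟩
  obtain ⟨y₁, y₂, z₁, z₂, w, a1, a2, a3, a4, a5, a6, -, -⟩ := hB.octagon hij hy hz h1 h2
  exact ⟨w, ((Raises.single a1).trans (Raises.single a2)).trans (Raises.single a3),
    ((Raises.single a4).trans (Raises.single a5)).trans (Raises.single a6)⟩

/-- Every element raises to exactly one highest weight element (Newman's lemma). -/
theorem RaisingAxioms.existsUnique_highest {B : Crystal A} (hB : B.RaisingAxioms)
    {d : (I → ℤ) → ℕ} (hd : B.IsGraded d) (x : B.carrier) :
    ∃! u, B.IsHighest u ∧ B.Raises x u := by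
  induction hn : d (B.wt x) using Nat.strong_induction_on generalizing x with
  | _ n ih =>
    subst hn
    by_cases hx : B.IsHighest x
    · exact ⟨x, ⟨hx, .refl⟩, fun v hv => (hv.2.eq_of_isHighest hx).symm⟩
    simp only [IsHighest, not_forall] at hx
    obtain ⟨i, hi⟩ := hx
    obtain ⟨y, hy⟩ := Option.ne_none_iff_exists'.1 hi
    obtain ⟨u, ⟨hu, hyu⟩, huniq⟩ := ih _ (hd hy) y rfl
    refine ⟨u, ⟨hu, (Raises.single hy).trans hyu⟩, ?_⟩
    rintro v ⟨hv, hxv⟩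
    rcases Relation.ReflTransGen.cases_head hxv with rfl | ⟨z, ⟨j, hz⟩, hzv⟩
    · exact absurd (hv i) hi
    obtain ⟨w, hyw, hzw⟩ := hB.confluent hy hz
    have hw : d (B.wt w) < d (B.wt x) := by
      have key : ∀ w, B.Raises y w → d (B.wt w) ≤ d (B.wt y) := by
        intro w h
        induction h with
        | refl => rfl
        | tail _ h ih => exact (hd h.choose_spec).le.trans ih
      exact (key w hyw).trans_lt (hd hy)
    obtain ⟨t, ⟨ht, hwt⟩, -⟩ := ih _ hw w rfl
    rw [← huniq t ⟨ht, hyw.trans hwt⟩]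
    exact (ih _ (hd hz) z rfl).unique ⟨hv, hzv⟩ ⟨ht, hzw.trans hwt⟩

/-- Every element of the component of a highest weight element `u` raises to `u`. -/
theorem RaisingAxioms.raises_of_reach {B : Crystal A} (hB : B.RaisingAxioms)
    {d : (I → ℤ) → ℕ} (hd : B.IsGraded d) {u x : B.carrier} (hu : B.IsHighest u)
    (h : B.Reach u x) : B.Raises x u := by
  induction h with
  | refl => exact .refl
  | @e c c' i _ hc ih =>
    obtain ⟨v, ⟨hv, hcv⟩, -⟩ := hB.existsUnique_highest hd c'
    have := (hB.existsUnique_highest hd c).unique ⟨hu, ih⟩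
      ⟨hv, (Raises.single hc).trans hcv⟩
    rwa [this]
  | @f c c' i _ hc ih =>
    exact (Raises.single ((B.f_eq_some_iff _ _ _).1 hc)).trans ih

/-- A component has at most one highest weight element. -/
theorem RaisingAxioms.eq_of_reach {B : Crystal A} (hB : B.RaisingAxioms) {d : (I → ℤ) → ℕ}
    (hd : B.IsGraded d) {u v : B.carrier} (hu : B.IsHighest u) (hv : B.IsHighest v)
    (h : B.Reach u v) : v = u :=
  (hB.raises_of_reach hd hu h).eq_of_isHighest hv

/-! ### Crystals with the same highest weights are isomorphic -/

variable {C D : Crystal A}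

/-- A weight preserving bijection between highest weight elements, as a relation. -/
structure HighestMatching (S : C.carrier → D.carrier → Prop) : Prop where
  highest_left : ∀ {u v}, S u v → C.IsHighest u
  highest_right : ∀ {u v}, S u v → D.IsHighest v
  wt_eq : ∀ {u v}, S u v → D.wt v = C.wt u
  exists_right : ∀ u, C.IsHighest u → ∃ v, S u v
  exists_left : ∀ v, D.IsHighest v → ∃ u, S u v
  right_unique : ∀ {u v v'}, S u v → S u v' → v = v'
  left_unique : ∀ {u u' v}, S u v → S u' v → u = u'

theorem HighestMatching.flip {S : C.carrier → D.carrier → Prop} (hS : HighestMatching S) :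
    HighestMatching (flip S) :=
  ⟨hS.highest_right, hS.highest_left, fun h => (hS.wt_eq h).symm, hS.exists_left, hS.exists_right,
    hS.left_unique, hS.right_unique⟩

/-- The elements `f_{i_1} ⋯ f_{i_k} u` and `f_{i_1} ⋯ f_{i_k} v`, for `u` and `v` related by `S`,
correspond to each other. -/
inductive Corr (S : C.carrier → D.carrier → Prop) : C.carrier → D.carrier → Prop
  | base {u v} : S u v → Corr S u v
  | step {x y x' y'} (i : I) : Corr S x x' → C.f i x = some y → D.f i x' = some y' → Corr S y y'

theorem Corr.flip {S : C.carrier → D.carrier → Prop} {x : C.carrier} {y : D.carrier}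
    (h : Corr S x y) : Corr (flip S) y x := by
  induction h with
  | base h => exact .base h
  | step i _ h1 h2 ih => exact .step i ih h2 h1

theorem Corr.wt_eq {S : C.carrier → D.carrier → Prop} (hS : HighestMatching S) {x : C.carrier}
    {y : D.carrier} (h : Corr S x y) : D.wt y = C.wt x := by
  induction h with
  | base h => exact hS.wt_eq h
  | step i _ h1 h2 ih =>
    funext j
    rw [C.wt_f i _ _ h1, D.wt_f i _ _ h2, ih]

/-- The correspondence is a function preserving string lengths on elements of depth less
than `n`. -/
structure CorrBelow (S : C.carrier → D.carrier → Prop) (d : (I → ℤ) → ℕ) (n : ℕ) : Prop where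
  exists_right : ∀ x, d (C.wt x) < n → ∃ x', Corr S x x'
  right_unique : ∀ {x x₁ x₂}, d (C.wt x) < n → Corr S x x₁ → Corr S x x₂ → x₁ = x₂
  eps_eq : ∀ {x x'}, d (C.wt x) < n → Corr S x x' → ∀ i, D.eps i x' = C.eps i x

theorem CorrBelow.phi_eq {S : C.carrier → D.carrier → Prop} {d : (I → ℤ) → ℕ} {n : ℕ}
    (h : CorrBelow S d n) (hS : HighestMatching S) {x : C.carrier} {x' : D.carrier}
    (hx : d (C.wt x) < n) (hxx : Corr S x x') (i : I) : D.phi i x' = C.phi i x := by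
  have h1 := C.phi_eq i x
  have h2 := D.phi_eq i x'
  rw [hxx.wt_eq hS, h.eps_eq hx hxx] at h2
  omega

theorem CorrBelow.exists_f {S : C.carrier → D.carrier → Prop} {d : (I → ℤ) → ℕ} {n : ℕ}
    (h : CorrBelow S d n) (hS : HighestMatching S) {x y : C.carrier} {x' : D.carrier} {i : I}
    (hx : d (C.wt x) < n) (hxx : Corr S x x') (hy : C.f i x = some y) :
    ∃ y', D.f i x' = some y' ∧ Corr S y y' := by
  have h1 := h.phi_eq hS hx hxx i
  have h2 := C.phi_of_f hy
  obtain ⟨y', hy'⟩ := D.exists_f (i := i) (b := x') (by omega)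
  exact ⟨y', hy', .step i hxx hy hy'⟩

/-- A corresponding arrow, starting at given corresponding elements and ending at a given
corresponding element. -/
theorem CorrBelow.map_f {S : C.carrier → D.carrier → Prop} {d : (I → ℤ) → ℕ} {n : ℕ}
    (h : CorrBelow S d n) (hS : HighestMatching S) {x y : C.carrier} {x' y' : D.carrier} {i : I}
    (hx : d (C.wt x) < n) (hy : d (C.wt y) < n) (hxx : Corr S x x') (hyy : Corr S y y')
    (hxy : C.f i x = some y) : D.f i x' = some y' := by
  obtain ⟨y'', h1, h2⟩ := h.exists_f hS hx hxx hxy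
  rw [h1, h.right_unique hy hyy h2]

/-- If `e_i` and `e_j` span a square at `x`, then the two elements of `D` corresponding to `x` agree,
because the axioms for lowering operators at the top of the square give a square in `D`. -/
theorem CorrBelow.eq_of_square {S : C.carrier → D.carrier → Prop} {d : (I → ℤ) → ℕ} {n : ℕ}
    (h : CorrBelow S d n) (hA : IsSimplyLaced A) (hS : HighestMatching S) (hd : C.IsGraded d)
    (hC : C.IsStembridge) (hD : D.IsStembridge) {i j : I} (hij : i ≠ j) {x y z : C.carrier}
    {y' z' x₁ x₂ : D.carrier} (hx : d (C.wt x) ≤ n) (hy : C.e i x = some y)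
    (hz : C.e j x = some z) (hyy : Corr S y y') (hzz : Corr S z z') (h1 : D.f i y' = some x₁)
    (h2 : D.f j z' = some x₂) (heps : C.eps j y = C.eps j x) : x₁ = x₂ := by
  obtain ⟨h3, w, hw1, hw2⟩ := hC.raising.square hij hy hz heps
  have hdy := (hd hy).trans_le hx
  have hdz := (hd hz).trans_le hx
  have hdw := (hd hw1).trans hdy
  obtain ⟨w', hww⟩ := h.exists_right w hdw
  have k1 := h.map_f hS hdw hdy hww hyy ((C.f_eq_some_iff _ _ _).2 hw1)
  have k2 := h.map_f hS hdw hdz hww hzz ((C.f_eq_some_iff _ _ _).2 hw2)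
  have a1 := hC.raising.adj_cases hA hij.symm hz
  have a2 := C.phi_of_e hy
  have a3 := C.phi_of_e hw2
  have a4 := h.phi_eq hS hdw hww i
  have a5 := h.phi_eq hS hdy hyy i
  have hs := hA.symm i j
  obtain ⟨-, v, hv1, hv2⟩ := hD.lowering.square hij.symm (x := w') (y := y') (z := z') k1 k2
    (by change D.phi i y' = D.phi i w'; omega)
  have hv1 : D.f i y' = some v := hv1
  have hv2 : D.f j z' = some v := hv2
  rw [h1] at hv1
  rw [h2] at hv2
  rw [Option.some.inj hv1, Option.some.inj hv2]

/-- The elements of `D` corresponding to `x` by way of `e_i x` and of `e_j x` agree. -/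
theorem CorrBelow.eq_of_f {S : C.carrier → D.carrier → Prop} {d : (I → ℤ) → ℕ} {n : ℕ}
    (h : CorrBelow S d n) (hA : IsSimplyLaced A) (hS : HighestMatching S) (hd : C.IsGraded d)
    (hC : C.IsStembridge) (hD : D.IsStembridge) {i j : I} {x y z : C.carrier}
    {y' z' x₁ x₂ : D.carrier} (hx : d (C.wt x) ≤ n) (hy : C.e i x = some y)
    (hz : C.e j x = some z) (hyy : Corr S y y') (hzz : Corr S z z') (h1 : D.f i y' = some x₁)
    (h2 : D.f j z' = some x₂) : x₁ = x₂ := by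
  have hdy := (hd hy).trans_le hx
  have hdz := (hd hz).trans_le hx
  by_cases hij : i = j
  · subst hij
    obtain rfl := Option.some.inj (hy.symm.trans hz)
    obtain rfl := h.right_unique hdy hyy hzz
    exact Option.some.inj (h1.symm.trans h2)
  rcases hC.raising.adj hij hy with e1 | ⟨-, e1⟩
  · exact h.eq_of_square hA hS hd hC hD hij hx hy hz hyy hzz h1 h2 e1
  rcases hC.raising.adj (Ne.symm hij) hz with e2 | ⟨-, e2⟩
  · exact (h.eq_of_square hA hS hd hC hD (Ne.symm hij) hx hz hy hzz hyy h2 h1 e2).symm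
  obtain ⟨y₁, y₂, z₁, z₂, w, a1, a2, a3, a4, a5, a6, a7, a8⟩ :=
    hC.raising.octagon hij hy hz e1 e2
  -- The octagon at `x` is transported to `D` from its top element `w`.
  have dy₁ := (hd a1).trans hdy
  have dy₂ := (hd a2).trans dy₁
  have dw := (hd a3).trans dy₂
  have dz₁ := (hd a4).trans hdz
  have dz₂ := (hd a5).trans dz₁
  obtain ⟨w', hww⟩ := h.exists_right w dw
  obtain ⟨y₁', hy₁⟩ := h.exists_right y₁ dy₁
  obtain ⟨y₂', hy₂⟩ := h.exists_right y₂ dy₂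
  obtain ⟨z₁', hz₁⟩ := h.exists_right z₁ dz₁
  obtain ⟨z₂', hz₂⟩ := h.exists_right z₂ dz₂
  have b1 := h.map_f hS dw dy₂ hww hy₂ ((C.f_eq_some_iff _ _ _).2 a3)
  have b2 := h.map_f hS dy₂ dy₁ hy₂ hy₁ ((C.f_eq_some_iff _ _ _).2 a2)
  have b3 := h.map_f hS dy₁ hdy hy₁ hyy ((C.f_eq_some_iff _ _ _).2 a1)
  have b4 := h.map_f hS dw dz₂ hww hz₂ ((C.f_eq_some_iff _ _ _).2 a6)
  have b5 := h.map_f hS dz₂ dz₁ hz₂ hz₁ ((C.f_eq_some_iff _ _ _).2 a5)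
  have b6 := h.map_f hS dz₁ hdz hz₁ hzz ((C.f_eq_some_iff _ _ _).2 a4)
  have hA1 : A j i = -1 := by
    rcases hC.raising.adj hij hy with e | ⟨e, -⟩ <;> omega
  have hs := hA.symm i j
  have hAd := hA.diag
  have n1 : C.phi j y₂ = C.phi j w + 1 := by
    have c1 := C.eps_of_e a1
    have c2 := C.eps_of_e a2
    have c3 := C.wt_e a3 j
    have c4 := C.phi_eq j w
    have c5 := C.phi_eq j y₂
    omega
  have n2 : C.phi i z₂ = C.phi i w + 1 := by
    have c1 := C.eps_of_e a4
    have c2 := C.eps_of_e a5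
    have c3 := C.wt_e a6 i
    have c4 := C.phi_eq i w
    have c5 := C.phi_eq i z₂
    omega
  rw [← h.phi_eq hS dw hww, ← h.phi_eq hS dy₂ hy₂] at n1
  rw [← h.phi_eq hS dw hww, ← h.phi_eq hS dz₂ hz₂] at n2
  obtain ⟨p₁, p₂, q₁, q₂, v, c1, c2, c3, c4, c5, c6, -, -⟩ :=
    hD.lowering.octagon hij (x := w') (y := y₂') (z := z₂') b1 b4 n1 n2
  have c1 : D.f j y₂' = some p₁ := c1
  have c2 : D.f j p₁ = some p₂ := c2
  have c3 : D.f i p₂ = some v := c3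
  have c4 : D.f i z₂' = some q₁ := c4
  have c5 : D.f i q₁ = some q₂ := c5
  have c6 : D.f j q₂ = some v := c6
  obtain rfl := Option.some.inj (b2.symm.trans c1)
  obtain rfl := Option.some.inj (b3.symm.trans c2)
  obtain rfl := Option.some.inj (b5.symm.trans c4)
  obtain rfl := Option.some.inj (b6.symm.trans c5)
  exact Option.some.inj ((h1.symm.trans c3).trans (h2.symm.trans c6).symm)

theorem CorrBelow.right_unique_succ {S : C.carrier → D.carrier → Prop} {d : (I → ℤ) → ℕ} {n : ℕ}
    (h : CorrBelow S d n) (hA : IsSimplyLaced A) (hS : HighestMatching S) (hd : C.IsGraded d)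
    (hC : C.IsStembridge) (hD : D.IsStembridge) {x : C.carrier} {x₁ x₂ : D.carrier}
    (hx : d (C.wt x) ≤ n) (h1 : Corr S x x₁) (h2 : Corr S x x₂) : x₁ = x₂ := by
  cases h1 with
  | base h1 =>
    cases h2 with
    | base h2 => exact hS.right_unique h1 h2
    | step i _ h3 _ => simp [C.f_eq_some_iff, hS.highest_left h1 i] at h3
  | step i k1 k2 k3 =>
    rw [C.f_eq_some_iff] at k2
    cases h2 with
    | base h2 => simp [hS.highest_left h2 i] at k2
    | step j m1 m2 m3 =>
      rw [C.f_eq_some_iff] at m2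
      exact h.eq_of_f hA hS hd hC hD hx k2 m2 k1 m1 k3 m3

theorem CorrBelow.exists_right_succ {S : C.carrier → D.carrier → Prop} {d : (I → ℤ) → ℕ} {n : ℕ}
    (h : CorrBelow S d n) (hS : HighestMatching S) (hd : C.IsGraded d) {x : C.carrier}
    (hx : d (C.wt x) ≤ n) : ∃ x', Corr S x x' := by
  by_cases hh : C.IsHighest x
  · obtain ⟨v, hv⟩ := hS.exists_right x hh
    exact ⟨v, .base hv⟩
  simp only [IsHighest, not_forall] at hh
  obtain ⟨i, hi⟩ := hh
  obtain ⟨y, hy⟩ := Option.ne_none_iff_exists'.1 hi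
  have hdy := (hd hy).trans_le hx
  obtain ⟨y', hyy⟩ := h.exists_right y hdy
  obtain ⟨x', -, hx'⟩ := h.exists_f hS hdy hyy ((C.f_eq_some_iff _ _ _).2 hy)
  exact ⟨x', hx'⟩

theorem CorrBelow.eps_le_succ {S : C.carrier → D.carrier → Prop} {d : (I → ℤ) → ℕ} {n : ℕ}
    (h : CorrBelow S d n) (hA : IsSimplyLaced A) (hS : HighestMatching S) (hd : C.IsGraded d)
    (hC : C.IsStembridge) (hD : D.IsStembridge) {x : C.carrier} {x' : D.carrier}
    (hx : d (C.wt x) ≤ n) (hxx : Corr S x x') (i : I) : C.eps i x ≤ D.eps i x' := by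
  cases hy : C.e i x with
  | none => rw [C.e_eq_none_iff] at hy; omega
  | some y =>
    have hdy := (hd hy).trans_le hx
    obtain ⟨y', hyy⟩ := h.exists_right y hdy
    obtain ⟨x'', h1, h2⟩ := h.exists_f hS hdy hyy ((C.f_eq_some_iff _ _ _).2 hy)
    obtain rfl := h.right_unique_succ hA hS hd hC hD hx hxx h2
    rw [C.eps_of_e hy, D.eps_of_f h1, h.eps_eq hdy hyy]

/-- By symmetry the correspondence is a bijection. The induction treats both directions together,
since `ε_i` on one side is bounded by `ε_i` on the other. -/
theorem corrBelow {S : C.carrier → D.carrier → Prop} {d : (I → ℤ) → ℕ} (hA : IsSimplyLaced A)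
    (hS : HighestMatching S) (hdC : C.IsGraded d) (hdD : D.IsGraded d)
    (hC : C.IsStembridge) (hD : D.IsStembridge) (n : ℕ) :
    CorrBelow S d n ∧ CorrBelow (flip S) d n := by
  induction n with
  | zero => exact ⟨⟨by simp, by simp, by simp⟩, ⟨by simp, by simp, by simp⟩⟩
  | succ n ih =>
    obtain ⟨h1, h2⟩ := ih
    refine ⟨⟨fun x hx => h1.exists_right_succ hS hdC (Nat.lt_succ_iff.1 hx),
      fun hx k1 k2 => h1.right_unique_succ hA hS hdC hC hD (Nat.lt_succ_iff.1 hx) k1 k2,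
      fun {x x'} hx k i => ?_⟩,
      ⟨fun x hx => h2.exists_right_succ hS.flip hdD (Nat.lt_succ_iff.1 hx),
      fun hx k1 k2 => h2.right_unique_succ hA hS.flip hdD hD hC (Nat.lt_succ_iff.1 hx) k1 k2,
      fun {x x'} hx k i => ?_⟩⟩
    · rw [Nat.lt_succ_iff] at hx
      have hx' : d (D.wt x') ≤ n := by rwa [k.wt_eq hS]
      exact le_antisymm (h2.eps_le_succ hA hS.flip hdD hD hC hx' k.flip i)
        (h1.eps_le_succ hA hS hdC hC hD hx k i)
    · rw [Nat.lt_succ_iff] at hx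
      have hx' : d (C.wt x') ≤ n := by rwa [k.wt_eq hS.flip]
      exact le_antisymm (h1.eps_le_succ hA hS hdC hC hD hx' k.flip i)
        (h2.eps_le_succ hA hS.flip hdD hD hC hx k i)

/-- Two crystals satisfying Stembridge's axioms, in which raising terminates, are isomorphic as
soon as there is a weight preserving bijection between their highest weight elements. -/
theorem HighestMatching.nonempty_iso {S : C.carrier → D.carrier → Prop} {d : (I → ℤ) → ℕ}
    (hA : IsSimplyLaced A) (hS : HighestMatching S) (hdC : C.IsGraded d) (hdD : D.IsGraded d)
    (hC : C.IsStembridge) (hD : D.IsStembridge) : Nonempty (Iso C D) := by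
  have key := corrBelow hA hS hdC hdD hC hD
  choose F hF using fun x : C.carrier =>
    (key (d (C.wt x) + 1)).1.exists_right x (Nat.lt_succ_self _)
  choose G hG using fun x : D.carrier =>
    (key (d (D.wt x) + 1)).2.exists_right x (Nat.lt_succ_self _)
  have Funiq : ∀ {x x'}, Corr S x x' → x' = F x := fun {x x'} h =>
    (key (d (C.wt x) + 1)).1.right_unique (Nat.lt_succ_self _) h (hF x)
  have Guniq : ∀ {x x'}, Corr S x x' → x = G x' := fun {x x'} h =>
    (key (d (D.wt x') + 1)).2.right_unique (Nat.lt_succ_self _) h.flip (hG x')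
  have hwt : ∀ x, D.wt (F x) = C.wt x := fun x => (hF x).wt_eq hS
  have heps : ∀ i x, D.eps i (F x) = C.eps i x := fun i x =>
    (key (d (C.wt x) + 1)).1.eps_eq (Nat.lt_succ_self _) (hF x) i
  have hphi : ∀ i x, D.phi i (F x) = C.phi i x := fun i x =>
    (key (d (C.wt x) + 1)).1.phi_eq hS (Nat.lt_succ_self _) (hF x) i
  have hmap : ∀ i x y, C.f i x = some y → D.f i (F x) = some (F y) := by
    intro i x y h
    obtain ⟨y', h1, h2⟩ := (key (d (C.wt x) + 1)).1.exists_f hS (Nat.lt_succ_self _) (hF x) h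
    rw [h1, Funiq h2]
  refine ⟨⟨⟨F, G, fun x => (Guniq (hF x)).symm, fun x => (Funiq (hG x).flip).symm⟩, hwt, heps, hphi,
    fun i x => ?_, fun i x => ?_⟩⟩
  · change (C.e i x).map F = D.e i (F x)
    cases h : C.e i x with
    | none =>
      rw [C.e_eq_none_iff] at h
      rw [Option.map_none, eq_comm, D.e_eq_none_iff, heps, h]
    | some y =>
      have := hmap i y x ((C.f_eq_some_iff _ _ _).2 h)
      rw [Option.map_some, (D.f_eq_some_iff _ _ _).1 this]
  · change (C.f i x).map F = D.f i (F x)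
    cases h : C.f i x with
    | none =>
      rw [C.f_eq_none_iff] at h
      rw [Option.map_none, eq_comm, D.f_eq_none_iff, hphi, h]
    | some y => rw [Option.map_some, hmap i x y h]

end Crystal

variable {I : Type} {A : Matrix I I ℤ}

/-! ### Chains in tensor products of minuscule crystals -/

/-- The dominance order: `b - c` is a sum of simple roots. -/
def Dominates [Fintype I] (A : Matrix I I ℤ) (b c : I → ℤ) : Prop :=
  ∃ k : I → ℕ, ∀ j, b j = c j + ∑ i, A j i * k i

section Dominates

variable [Fintype I]

theorem Dominates.refl (b : I → ℤ) : Dominates A b b := ⟨0, by simp⟩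

theorem Dominates.trans {a b c : I → ℤ} (h : Dominates A a b) (h' : Dominates A b c) :
    Dominates A a c := by
  obtain ⟨k, hk⟩ := h
  obtain ⟨m, hm⟩ := h'
  refine ⟨k + m, fun j => ?_⟩
  simp only [hk, hm, Pi.add_apply, Nat.cast_add, mul_add, Finset.sum_add_distrib]
  ring

instance : IsTrans (I → ℤ) (Dominates A) := ⟨fun _ _ _ => Dominates.trans⟩

theorem dominates_of_raise {b c : I → ℤ} {i : I} (h : ∀ j, b j = c j + A j i) :
    Dominates A b c := by
  classical
  refine ⟨Pi.single i 1, fun j => ?_⟩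
  rw [h, Finset.sum_eq_single i]
  · simp
  · intro k _ hk
    simp [hk]
  · simp

/-- If `b` dominates `c` and has the larger `i`-th coordinate, then `α_i` occurs in `b - c`. -/
theorem Dominates.of_lt {b c c' : I → ℤ} {i : I} (hA : IsSimplyLaced A) (h : Dominates A b c)
    (hi : c i < b i) (hc : ∀ j, c' j = c j + A j i) : Dominates A b c' := by
  classical
  obtain ⟨k, hk⟩ := h
  have hki : 0 < k i := by
    by_contra h0
    have h1 := hk i
    have : ∑ j, A i j * k j ≤ 0 := by
      refine Finset.sum_nonpos fun j _ => ?_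
      by_cases hj : i = j
      · subst hj
        simp [Nat.eq_zero_of_not_pos h0]
      · have h2 := hA.off_diag i j hj
        have h3 : (0 : ℤ) ≤ k j := by positivity
        rcases h2 with h2 | h2 <;> rw [h2] <;> omega
    omega
  refine ⟨Function.update k i (k i - 1), fun j => ?_⟩
  rw [hk, hc, ← Finset.add_sum_erase _ _ (Finset.mem_univ i),
    ← Finset.add_sum_erase (a := i) _ (fun l => A j l * (Function.update k i (k i - 1) l : ℕ))
      (Finset.mem_univ i)]
  have : ∑ l ∈ Finset.univ.erase i, A j l * (Function.update k i (k i - 1) l : ℕ) =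
      ∑ l ∈ Finset.univ.erase i, A j l * (k l : ℤ) :=
    Finset.sum_congr rfl fun l hl => by rw [Function.update_of_ne (Finset.ne_of_mem_erase hl)]
  rw [this, Function.update_self, Nat.cast_sub hki]
  push_cast
  ring

theorem Dominates.raise_left {b b' c : I → ℤ} {i : I} (h : Dominates A b c)
    (hb : ∀ j, b' j = b j + A j i) : Dominates A b' c :=
  (dominates_of_raise hb).trans h

theorem Dominates.lower_right {b c c' : I → ℤ} {i : I} (h : Dominates A b c)
    (hc : ∀ j, c' j = c j - A j i) : Dominates A b c' :=
  h.trans (dominates_of_raise (i := i) fun j => by rw [hc]; ring)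

theorem Dominates.lower_left {b b' c : I → ℤ} {i : I} (hA : IsSimplyLaced A)
    (h : Dominates A b c) (hi : c i < b i) (hb : ∀ j, b' j = b j - A j i) : Dominates A b' c := by
  obtain ⟨k, hk⟩ := h.of_lt hA hi (c' := fun j => c j + A j i) fun _ => rfl
  refine ⟨k, fun j => ?_⟩
  rw [hb, hk]
  ring

end Dominates

/-- The tensor factors of an element of a tensor product of minuscule crystals, as weights. -/
def letters (hA : ∀ i, A i i = 2) :
    (L : List {l : I → ℤ // IsMinuscule A l}) → (minusculeTensor A hA L).carrier → List (I → ℤ)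
  | [], _ => []
  | _ :: L, x => x.1.1 :: letters hA L x.2

theorem letters_injective (hA : ∀ i, A i i = 2) :
    ∀ L, Function.Injective (letters (A := A) hA L)
  | [] => fun _ _ _ => rfl
  | _ :: L => fun x y h => by
    obtain ⟨h1, h2⟩ := List.cons_eq_cons.1 h
    exact Prod.ext (Subtype.ext h1) (letters_injective hA L h2)

theorem length_letters (hA : ∀ i, A i i = 2) :
    ∀ L x, (letters (A := A) hA L x).length = L.length
  | [], _ => rfl
  | _ :: L, x => congrArg (· + 1) (length_letters hA L x.2)

theorem wt_eq_sum_letters (hA : ∀ i, A i i = 2) (j : I) :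
    ∀ L x, (minusculeTensor A hA L).wt x j = ((letters hA L x).map (· j)).sum
  | [], _ => rfl
  | _ :: L, x => congrArg (x.1.1 j + ·) (wt_eq_sum_letters hA j L x.2)

theorem head_le_of_phi_eq_zero (hA : ∀ i, A i i = 2)
    {L : List {l : I → ℤ // IsMinuscule A l}} {t : (minusculeTensor A hA L).carrier} {i : I}
    (h : (minusculeTensor A hA L).phi i t = 0) :
    ∀ y ∈ (letters hA L t).head?, y i ≤ 0 := by
  cases L with
  | nil => simp [letters]
  | cons l L =>
    obtain ⟨x, t⟩ := t
    intro y hy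
    obtain rfl : x.1 = y := Option.some.inj hy
    have h : (x.1 i).toNat + _ = 0 := h
    omega

section Chains

variable [Fintype I] (hA : IsSimplyLaced A) {L : List {l : I → ℤ // IsMinuscule A l}}

/-- An element of a tensor product of minuscule crystals is a chain if its tensor factors decrease
in the dominance order. -/
def Chain (x : (minusculeTensor A hA.diag L).carrier) : Prop :=
  (letters hA.diag L x).IsChain (Dominates A)

theorem chain_cons_iff {l : {l : I → ℤ // IsMinuscule A l}}
    {x : (minusculeCrystal A hA.diag l.1 l.2).carrier}
    {t : (minusculeTensor A hA.diag L).carrier} :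
    Chain hA (L := l :: L) (x, t) ↔
      (∀ y ∈ (letters hA.diag L t).head?, Dominates A x.1 y) ∧ Chain hA t :=
  List.isChain_cons

/-- Raising an element of a tensor product keeps its first factor dominated by `b`. If the first
factor itself is raised, then `φ_i` vanishes, so `b` has a larger `i`-th coordinate than this
factor. -/
theorem head_e {t t' : (minusculeTensor A hA.diag L).carrier} {i : I}
    (h : (minusculeTensor A hA.diag L).e i t = some t') {b : I → ℤ}
    (hb : ∀ y ∈ (letters hA.diag L t).head?, Dominates A b y)
    (hi : (minusculeTensor A hA.diag L).phi i t = 0 → 0 ≤ b i) :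
    ∀ y ∈ (letters hA.diag L t').head?, Dominates A b y := by
  cases L with
  | nil => simp [letters]
  | cons l L =>
    obtain ⟨x, t⟩ := t
    rcases tensor_e_cases h with ⟨h1, x', hx, rfl⟩ | ⟨h1, u, hu, rfl⟩
    · obtain ⟨h2, h3⟩ := minuscule_e_iff.1 hx
      have h1 : (minusculeTensor A hA.diag L).phi i t < (-x.1 i).toNat := h1
      have h4 : (x.1 i).toNat + ((minusculeTensor A hA.diag L).phi i t - (-x.1 i).toNat) = 0 := by
        omega
      have h5 := hi h4
      intro y hy
      obtain rfl : x'.1 = y := Option.some.inj hy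
      exact (hb x.1 rfl).of_lt hA (by omega) h3
    · intro y hy
      exact hb y hy

theorem head_f {t t' : (minusculeTensor A hA.diag L).carrier} {i : I}
    (h : (minusculeTensor A hA.diag L).f i t = some t') {b : I → ℤ}
    (hb : ∀ y ∈ (letters hA.diag L t).head?, Dominates A b y) :
    ∀ y ∈ (letters hA.diag L t').head?, Dominates A b y := by
  cases L with
  | nil => simp [letters]
  | cons l L =>
    obtain ⟨x, t⟩ := t
    rcases tensor_f_cases h with ⟨h1, u, hu, rfl⟩ | ⟨h1, x', hx, rfl⟩
    · intro y hy
      exact hb y hy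
    · obtain ⟨h2, h3⟩ := minuscule_f_iff.1 hx
      intro y hy
      obtain rfl : x'.1 = y := Option.some.inj hy
      exact (hb x.1 rfl).lower_right h3

theorem Chain.e {t t' : (minusculeTensor A hA.diag L).carrier} {i : I} (ht : Chain hA t)
    (h : (minusculeTensor A hA.diag L).e i t = some t') : Chain hA t' := by
  induction L with
  | nil => exact List.IsChain.nil
  | cons l L ih =>
    obtain ⟨x, t⟩ := t
    obtain ⟨hx, ht⟩ := (chain_cons_iff hA).1 ht
    rcases tensor_e_cases h with ⟨h1, x', hx', rfl⟩ | ⟨h1, u, hu, rfl⟩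
    · obtain ⟨h2, h3⟩ := minuscule_e_iff.1 hx'
      exact (chain_cons_iff hA).2 ⟨fun y hy => (hx y hy).raise_left h3, ht⟩
    · have h1 : (-x.1 i).toNat ≤ (minusculeTensor A hA.diag L).phi i t := h1
      exact (chain_cons_iff hA).2 ⟨head_e hA hu hx (by omega), ih ht hu⟩

theorem Chain.f {t t' : (minusculeTensor A hA.diag L).carrier} {i : I} (ht : Chain hA t)
    (h : (minusculeTensor A hA.diag L).f i t = some t') : Chain hA t' := by
  induction L with
  | nil => exact List.IsChain.nil
  | cons l L ih =>
    obtain ⟨x, t⟩ := t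
    obtain ⟨hx, ht⟩ := (chain_cons_iff hA).1 ht
    rcases tensor_f_cases h with ⟨h1, u, hu, rfl⟩ | ⟨h1, x', hx', rfl⟩
    · exact (chain_cons_iff hA).2 ⟨head_f hA hu hx, ih ht hu⟩
    · obtain ⟨h2, h3⟩ := minuscule_f_iff.1 hx'
      have h1 : (minusculeTensor A hA.diag L).phi i t ≤ (-x.1 i).toNat := h1
      have h4 := head_le_of_phi_eq_zero hA.diag (t := t) (i := i) (by omega)
      exact (chain_cons_iff hA).2
        ⟨fun y hy => (hx y hy).lower_left hA (by have := h4 y hy; omega) h3, ht⟩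

theorem Chain.of_reach {t t' : (minusculeTensor A hA.diag L).carrier} (ht : Chain hA t)
    (h : (minusculeTensor A hA.diag L).Reach t t') : Chain hA t' := by
  induction h with
  | refl => exact ht
  | e i _ h ih => exact ih.e hA h
  | f i _ h ih => exact ih.f hA h

end Chains

/-! ### Termination of raising and the top element -/

theorem wt_bounds (hA : ∀ i, A i i = 2) (j : I) :
    ∀ L x, |(minusculeTensor A hA L).wt x j| ≤ L.length
  | [], _ => le_rfl
  | l :: L, x => by
    have h1 := l.2.bounds _ x.1.2 j
    have h2 : |x.1.1 j| ≤ 1 := abs_le.2 h1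
    have h3 := wt_bounds hA j L x.2
    have h4 := abs_add_le (x.1.1 j) ((minusculeTensor A hA L).wt x.2 j)
    have h5 : (minusculeTensor A hA (l :: L)).wt x j =
      x.1.1 j + (minusculeTensor A hA L).wt x.2 j := rfl
    rw [h5, List.length_cons]
    push_cast
    omega

/-- A grading of crystals with bounded weights, by a functional `c` that is positive on the simple
roots. -/
def depth [Fintype I] (c : I → ℤ) (n : ℕ) (μ : I → ℤ) : ℕ :=
  (n * ∑ j, |c j| - ∑ j, c j * μ j).toNat

theorem isGraded_depth [Fintype I] {B : Crystal A} {c : I → ℤ} (hc : ∀ i, 0 < ∑ j, c j * A j i)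
    {n : ℕ} (hB : ∀ x j, |B.wt x j| ≤ n) : B.IsGraded (depth c n) := by
  intro i x y h
  have h1 : ∑ j, c j * B.wt y j = ∑ j, c j * B.wt x j + ∑ j, c j * A j i := by
    rw [← Finset.sum_add_distrib]
    exact Finset.sum_congr rfl fun j _ => by rw [B.wt_e h]; ring
  have h2 : ∑ j, c j * B.wt y j ≤ n * ∑ j, |c j| := by
    rw [Finset.mul_sum]
    refine Finset.sum_le_sum fun j _ => ?_
    calc c j * B.wt y j ≤ |c j * B.wt y j| := le_abs_self _
      _ = |c j| * |B.wt y j| := abs_mul _ _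
      _ ≤ |c j| * n := by gcongr; exact hB y j
      _ = n * |c j| := mul_comm _ _
  have h3 := hc i
  simp only [depth]
  omega

theorem isHighest_topElement (hA : ∀ i, A i i = 2) :
    ∀ L, (minusculeTensor A hA L).IsHighest (topElement A hA L)
  | [] => fun _ => rfl
  | l :: L => by
    rw [isHighest_iff]
    intro i
    have h1 := isHighest_iff.1 (isHighest_topElement hA L) i
    have h2 := l.2.dominant i
    change (minusculeTensor A hA L).eps i (topElement A hA L) + ((-l.1 i).toNat - _) = 0
    omega

theorem wt_topElement (hA : ∀ i, A i i = 2) (j : I) :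
    ∀ L, (minusculeTensor A hA L).wt (topElement A hA L) j = (L.map (·.1 j)).sum
  | [] => rfl
  | l :: L => congrArg (l.1 j + ·) (wt_topElement hA j L)

namespace Crystal

theorem isHighest_component_iff {B : Crystal A} {b : B.carrier} {x : (B.component b).carrier} :
    (B.component b).IsHighest x ↔ B.IsHighest x.1 := by
  rw [isHighest_iff, isHighest_iff]
  rfl

theorem isHighest_directSum_iff {K : Type} {B : K → Crystal A} {x : (directSum B).carrier} :
    (directSum B).IsHighest x ↔ (B x.1).IsHighest x.2 := by
  rw [isHighest_iff, isHighest_iff]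
  rfl

end Crystal

/-! ### The 56 weights of the minuscule representation of `E₇` -/

theorem isSimplyLaced_E₇ : IsSimplyLaced CartanMatrix.E₇ where
  diag := diag_E₇
  symm i j := by fin_cases i <;> fin_cases j <;> rfl
  off_diag i j h := by
    fin_cases i <;> fin_cases j <;> first | exact .inl rfl | exact .inr rfl | exact absurd rfl h

/-- The weights in the Weyl group orbit of `ϖ₇`. -/
def minusculeWeights : List (Fin 7 → ℤ) :=
  [
    ![0, 0, 0, 0, 0, 0, 1], ![0, 0, 0, 0, 0, 1, -1], ![0, 0, 0, 0, 1, -1, 0],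
    ![0, 0, 0, 1, -1, 0, 0], ![0, 1, 1, -1, 0, 0, 0], ![0, -1, 1, 0, 0, 0, 0],
    ![1, 1, -1, 0, 0, 0, 0], ![1, -1, -1, 1, 0, 0, 0], ![-1, 1, 0, 0, 0, 0, 0],
    ![-1, -1, 0, 1, 0, 0, 0], ![1, 0, 0, -1, 1, 0, 0], ![-1, 0, 1, -1, 1, 0, 0],
    ![1, 0, 0, 0, -1, 1, 0], ![0, 0, -1, 0, 1, 0, 0], ![-1, 0, 1, 0, -1, 1, 0],
    ![1, 0, 0, 0, 0, -1, 1], ![0, 0, -1, 1, -1, 1, 0], ![-1, 0, 1, 0, 0, -1, 1],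
    ![1, 0, 0, 0, 0, 0, -1], ![0, 1, 0, -1, 0, 1, 0], ![0, 0, -1, 1, 0, -1, 1],
    ![-1, 0, 1, 0, 0, 0, -1], ![0, -1, 0, 0, 0, 1, 0], ![0, 1, 0, -1, 1, -1, 1],
    ![0, 0, -1, 1, 0, 0, -1], ![0, -1, 0, 0, 1, -1, 1], ![0, 1, 0, 0, -1, 0, 1],
    ![0, 1, 0, -1, 1, 0, -1], ![0, -1, 0, 1, -1, 0, 1], ![0, -1, 0, 0, 1, 0, -1],
    ![0, 1, 0, 0, -1, 1, -1], ![0, 0, 1, -1, 0, 0, 1], ![0, -1, 0, 1, -1, 1, -1],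
    ![0, 1, 0, 0, 0, -1, 0], ![1, 0, -1, 0, 0, 0, 1], ![0, 0, 1, -1, 0, 1, -1],
    ![0, -1, 0, 1, 0, -1, 0], ![-1, 0, 0, 0, 0, 0, 1], ![1, 0, -1, 0, 0, 1, -1],
    ![0, 0, 1, -1, 1, -1, 0], ![-1, 0, 0, 0, 0, 1, -1], ![1, 0, -1, 0, 1, -1, 0],
    ![0, 0, 1, 0, -1, 0, 0], ![-1, 0, 0, 0, 1, -1, 0], ![1, 0, -1, 1, -1, 0, 0],
    ![-1, 0, 0, 1, -1, 0, 0], ![1, 1, 0, -1, 0, 0, 0], ![-1, 1, 1, -1, 0, 0, 0],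
    ![1, -1, 0, 0, 0, 0, 0], ![-1, -1, 1, 0, 0, 0, 0], ![0, 1, -1, 0, 0, 0, 0],
    ![0, -1, -1, 1, 0, 0, 0], ![0, 0, 0, -1, 1, 0, 0], ![0, 0, 0, 0, -1, 1, 0],
    ![0, 0, 0, 0, 0, -1, 1], ![0, 0, 0, 0, 0, 0, -1]]

theorem reflect_mem_minusculeWeights : ∀ μ ∈ minusculeWeights, ∀ i,
    (fun j => μ j - μ i * CartanMatrix.E₇ j i) ∈ minusculeWeights := by
  decide +kernel

theorem mem_minusculeWeights {μ : Fin 7 → ℤ}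
    (h : WeylOrbit CartanMatrix.E₇ (Pi.single 6 1) μ) : μ ∈ minusculeWeights := by
  induction h with
  | base => decide +kernel
  | reflect i _ ih => exact reflect_mem_minusculeWeights _ ih i

/-- Twice the inverse of the Cartan matrix of type `E₇`. -/
def doubleInverse : Matrix (Fin 7) (Fin 7) ℤ :=
  !![4, 4, 6, 8, 6, 4, 2; 4, 7, 8, 12, 9, 6, 3; 6, 8, 12, 16, 12, 8, 4;
    8, 12, 16, 24, 18, 12, 6; 6, 9, 12, 18, 15, 10, 5; 4, 6, 8, 12, 10, 8, 4;
    2, 3, 4, 6, 5, 4, 3]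

theorem doubleInverse_mul : doubleInverse * CartanMatrix.E₇ = (2 : ℤ) • 1 := by
  decide +kernel

/-- A decidable consequence of dominance: all coordinates in the basis of simple roots are at
least as large. -/
def RootGE (b c : Fin 7 → ℤ) : Prop :=
  ∀ i, 0 ≤ ∑ j, doubleInverse i j * (b j - c j)

instance (b c : Fin 7 → ℤ) : Decidable (RootGE b c) :=
  inferInstanceAs (Decidable (∀ _, _ ≤ _))

theorem Dominates.rootGE {b c : Fin 7 → ℤ} (h : Dominates CartanMatrix.E₇ b c) : RootGE b c := by
  obtain ⟨k, hk⟩ := h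
  intro i
  have h1 : (fun j => b j - c j) = CartanMatrix.E₇.mulVec fun j => (k j : ℤ) := by
    funext j
    rw [hk, Matrix.mulVec, dotProduct]
    ring
  have h2 : ∑ j, doubleInverse i j * (b j - c j) =
      (doubleInverse.mulVec (CartanMatrix.E₇.mulVec fun j => (k j : ℤ))) i := by
    rw [← h1]
    rfl
  rw [h2, Matrix.mulVec_mulVec, doubleInverse_mul]
  simp

theorem eq_of_rootGE_top : ∀ μ ∈ minusculeWeights, RootGE μ (Pi.single 6 1) →
    μ = Pi.single 6 1 := by
  decide +kernel

theorem eq_of_dominant : ∀ μ ∈ minusculeWeights, (∀ i, 0 ≤ μ i) → μ = Pi.single 6 1 := by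
  decide +kernel

/-! ### Highest weight words for a Levi subalgebra -/

section LatticeWord

/-- All suffixes of the word have a weight that is dominant for the nodes in `K`. -/
def LatticeWord (K : Set I) : List (I → ℤ) → Prop
  | [] => True
  | x :: t => LatticeWord K t ∧ ∀ i ∈ K, 0 ≤ x i + (t.map (· i)).sum

/-- An element is annihilated by the `e_i` with `i ∈ K` exactly when its factors form a lattice
word: for `x ⊗ t` this means that `t` is annihilated and `ε_i x ≤ φ_i t`, which is then the `i`-th
coordinate of the weight of `t`. -/
theorem latticeWord_letters_iff (hA : ∀ i, A i i = 2) (K : Set I) :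
    ∀ L x, LatticeWord K (letters hA L x) ↔ ∀ i ∈ K, (minusculeTensor A hA L).eps i x = 0
  | [], _ => ⟨fun _ _ _ => rfl, fun _ => trivial⟩
  | l :: L, x => by
    have ih := latticeWord_letters_iff hA K L x.2
    have key : ∀ i, (minusculeTensor A hA L).eps i x.2 = 0 →
        (0 ≤ x.1.1 i + ((letters hA L x.2).map (· i)).sum ↔
          (minusculeTensor A hA (l :: L)).eps i x = 0) := by
      intro i h
      have h1 := (minusculeTensor A hA L).phi_eq i x.2
      rw [wt_eq_sum_letters, h] at h1
      change _ ↔ (minusculeTensor A hA L).eps i x.2 +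
        ((-x.1.1 i).toNat - (minusculeTensor A hA L).phi i x.2) = 0
      omega
    simp only [letters, LatticeWord]
    rw [ih]
    constructor
    · rintro ⟨h1, h2⟩ i hi
      exact (key i (h1 i hi)).1 (h2 i hi)
    · intro h
      have h1 : ∀ i ∈ K, (minusculeTensor A hA L).eps i x.2 = 0 := fun i hi =>
        Nat.eq_zero_of_add_eq_zero_right (h i hi)
      exact ⟨h1, fun i hi => (key i (h1 i hi)).2 (h i hi)⟩

/-- Prepending `n` copies of `x` to a lattice word of dominant weight gives a lattice word if every
negative coordinate of `x` is compensated `n` times; the intermediate suffixes need no check. -/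
theorem LatticeWord.replicate_append {K : Set I} {x : I → ℤ} {t : List (I → ℤ)} (n : ℕ)
    (ht : LatticeWord K t) (h0 : ∀ i ∈ K, 0 ≤ (t.map (· i)).sum)
    (hx : ∀ i ∈ K, 0 ≤ x i ∨ 0 ≤ n * x i + (t.map (· i)).sum) :
    LatticeWord K (List.replicate n x ++ t) := by
  induction n with
  | zero => exact ht
  | succ n ih =>
    have hx' : ∀ i ∈ K, 0 ≤ x i ∨ 0 ≤ (n : ℤ) * x i + (t.map (· i)).sum := by
      intro i hi
      rcases le_or_gt 0 (x i) with h | h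
      · exact .inl h
      · refine .inr ?_
        have := (hx i hi).resolve_left (not_le.2 h)
        push_cast at this
        linarith
    refine ⟨ih hx', fun i hi => ?_⟩
    change 0 ≤ x i + ((List.replicate n x ++ t).map (· i)).sum
    rw [List.map_append, List.sum_append, List.map_replicate, List.sum_replicate, nsmul_eq_mul]
    rcases hx i hi with h | h
    · have := h0 i hi
      positivity
    · push_cast at h
      linarith

theorem exists_letters_eq (hA : ∀ i, A i i = 2) {l : {l : I → ℤ // IsMinuscule A l}} :
    ∀ w : List (I → ℤ), (∀ y ∈ w, WeylOrbit A l.1 y) →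
      ∃ x, letters hA (List.replicate w.length l) x = w
  | [], _ => ⟨(), rfl⟩
  | y :: w, h => by
    obtain ⟨x, hx⟩ := exists_letters_eq hA (l := l) w fun z hz => h z (List.mem_cons_of_mem _ hz)
    exact ⟨(⟨y, h y List.mem_cons_self⟩, x), congrArg (y :: ·) hx⟩

theorem weylOrbit_of_mem_letters (hA : ∀ i, A i i = 2) {l : {l : I → ℤ // IsMinuscule A l}} :
    ∀ n x, ∀ y ∈ letters hA (List.replicate n l) x, WeylOrbit A l.1 y
  | 0, _ => by simp [letters]
  | n + 1, x => by
    intro y hy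
    rcases List.mem_cons.1 hy with rfl | hy
    · exact x.1.2
    · exact weylOrbit_of_mem_letters hA n x.2 y hy

end LatticeWord

/-! ### The crystal `B(s ϖ₇)` as a set of chains -/

/-- A chain of highest weight is the top element: its last factor is dominant, hence `ϖ₇`, and the
others dominate `ϖ₇`. -/
theorem eq_topElement_of_isHighest : ∀ {s : ℕ}
    {x : (minusculeTensor CartanMatrix.E₇ diag_E₇
      (List.replicate s ⟨Pi.single 6 1, isMinuscule_E₇⟩)).carrier},
    Chain isSimplyLaced_E₇ x → (minusculeTensor CartanMatrix.E₇ diag_E₇ _).IsHighest x →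
      x = topElement CartanMatrix.E₇ diag_E₇ _
  | 0, _, _, _ => rfl
  | s + 1, (y, t), hx, hh => by
    obtain ⟨h1, h2⟩ := (chain_cons_iff isSimplyLaced_E₇).1 hx
    have h3 := (latticeWord_letters_iff diag_E₇ Set.univ _ _).2 fun i _ => isHighest_iff.1 hh i
    obtain ⟨h4, h5⟩ := h3
    have h6 := eq_topElement_of_isHighest h2 (isHighest_iff.2 fun i =>
      (latticeWord_letters_iff diag_E₇ Set.univ _ _).1 h4 i trivial)
    subst h6
    refine Prod.ext (Subtype.ext ?_) rfl
    have h7 := mem_minusculeWeights y.2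
    cases s with
    | zero => exact eq_of_dominant _ h7 fun i => by simpa [letters] using h5 i trivial
    | succ s => exact eq_of_rootGE_top _ h7 (h1 _ rfl).rootGE

theorem chain_topElement : ∀ s : ℕ, Chain isSimplyLaced_E₇
    (topElement CartanMatrix.E₇ diag_E₇ (List.replicate s ⟨Pi.single 6 1, isMinuscule_E₇⟩))
  | 0 => List.IsChain.nil
  | s + 1 => by
    refine (chain_cons_iff isSimplyLaced_E₇).2 ⟨?_, chain_topElement s⟩
    cases s with
    | zero => simp [letters]
    | succ s =>
      intro y hy
      obtain rfl := Option.some.inj hy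
      exact Dominates.refl _

/-- The coefficients are those of twice the half-sum of the positive coroots, a functional with the
value `2` on all simple roots. -/
theorem isGraded_E₇ {B : Crystal CartanMatrix.E₇} {n : ℕ} (hB : ∀ x j, |B.wt x j| ≤ n) :
    B.IsGraded (depth ![34, 49, 66, 96, 75, 52, 27] n) :=
  isGraded_depth (by decide +kernel) hB

/-- The component of the top element of `B(ϖ₇)^{⊗ s}` consists of all chains. -/
theorem reach_top_iff {s : ℕ}
    {x : (minusculeTensor CartanMatrix.E₇ diag_E₇
      (List.replicate s ⟨Pi.single 6 1, isMinuscule_E₇⟩)).carrier} :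
    (minusculeTensor CartanMatrix.E₇ diag_E₇ _).Reach (topElement CartanMatrix.E₇ diag_E₇ _) x ↔
      Chain isSimplyLaced_E₇ x := by
  refine ⟨(chain_topElement s).of_reach isSimplyLaced_E₇, fun h => ?_⟩
  obtain ⟨u, ⟨hu, hxu⟩, -⟩ := (isStembridge_minusculeTensor isSimplyLaced_E₇
    _).raising.existsUnique_highest (isGraded_E₇ fun x j => wt_bounds diag_E₇ j _ x) x
  have key : Chain isSimplyLaced_E₇ u ∧ ∀ v, (minusculeTensor CartanMatrix.E₇ diag_E₇ _).Reach v u →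
      (minusculeTensor CartanMatrix.E₇ diag_E₇ _).Reach v x := by
    clear hu
    induction hxu with
    | refl => exact ⟨h, fun v hv => hv⟩
    | tail _ hi ih =>
      obtain ⟨i, hi⟩ := hi
      exact ⟨ih.1.e _ hi, fun v hv => ih.2 v (.f i hv ((Crystal.f_eq_some_iff _ _ _ _).2 hi))⟩
  rw [← eq_topElement_of_isHighest key.1 hu]
  exact key.2 u .refl

/-! ### Highest weight chains for the Levi subalgebra of type `A₆` -/

/-- The eight weights that occur as tensor factors of the `A₆`-highest weight elements of
`B(s ϖ₇)`. They are listed in decreasing order, except that those with indices `3` and `4` are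
incomparable. -/
def highestLetter : Fin 8 → Fin 7 → ℤ :=
  ![![0, 0, 0, 0, 0, 0, 1], ![0, 0, 0, 0, 1, -1, 0], ![0, 1, 1, -1, 0, 0, 0],
    ![0, -1, 1, 0, 0, 0, 0], ![-1, 1, 0, 0, 0, 0, 0], ![-1, -1, 0, 1, 0, 0, 0],
    ![0, -1, 0, 0, 0, 1, 0], ![1, -1, 0, 0, 0, 0, 0]]

/-- The entries of a tuple, in the order of the corresponding letters. -/
def Tuple.count (m : Tuple) : Fin 8 → ℕ :=
  ![m.m₁, m.m₂, m.m₃, m.m₄', m.m₄, m.m₅, m.m₆, m.m₇]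

/-- The word with the multiplicities of letters recorded by `m`. -/
def Tuple.word (m : Tuple) : List (Fin 7 → ℤ) :=
  (List.finRange 8).flatMap fun l => List.replicate (m.count l) (highestLetter l)

theorem Tuple.word_eq (m : Tuple) : m.word =
    List.replicate m.m₁ (highestLetter 0) ++ (List.replicate m.m₂ (highestLetter 1) ++
    (List.replicate m.m₃ (highestLetter 2) ++ (List.replicate m.m₄' (highestLetter 3) ++
    (List.replicate m.m₄ (highestLetter 4) ++ (List.replicate m.m₅ (highestLetter 5) ++
    (List.replicate m.m₆ (highestLetter 6) ++ (List.replicate m.m₇ (highestLetter 7) ++ []))))))) :=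
  rfl

theorem Tuple.mem_word {m : Tuple} {y : Fin 7 → ℤ} :
    y ∈ m.word ↔ ∃ l, 0 < m.count l ∧ y = highestLetter l := by
  simp [Tuple.word, List.mem_flatMap, List.mem_replicate, Nat.pos_iff_ne_zero]

theorem Tuple.length_word (m : Tuple) : m.word.length =
    m.m₁ + m.m₂ + m.m₃ + m.m₄ + m.m₄' + m.m₅ + m.m₆ + m.m₇ := by
  rw [Tuple.word_eq]
  simp only [List.length_append, List.length_replicate, List.length_nil]
  omega

theorem Tuple.sum_word (m : Tuple) (k : Fin 6) : (m.word.map (· (levi k))).sum =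
    (![m.m₁, m.m₆ - m.m₂, m.m₂, m.m₅ - m.m₃, m.m₃ + m.m₄', m.m₇ - m.m₄ - m.m₅] : Fin 6 → ℤ) k := by
  rw [Tuple.word_eq]
  simp only [List.map_append, List.map_replicate, List.sum_append, List.sum_replicate]
  fin_cases k <;> simp [levi, highestLetter] <;> ring

theorem Tuple.Admissible.sum_word_eq_weight {s : ℕ} {m : Tuple} (hm : m.Admissible s)
    (k : Fin 6) : (m.word.map (· (levi k))).sum = m.weight k := by
  obtain ⟨h1, h2, h3, -, -⟩ := hm
  rw [Tuple.sum_word]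
  fin_cases k <;> simp [Tuple.weight] <;> omega

/-- The weight determines an admissible tuple: the entries `m₁`, `m₂`, `m₆` can be read off, and
together with the total `s` the weight determines `m₃ + m₄`, whence `m₃ = min (m₃ + m₄) (m₃ + m₄')`
because one of `m₄` and `m₄'` vanishes. -/
theorem Tuple.Admissible.eq_of_weight_eq {s : ℕ} {m m' : Tuple} (hm : m.Admissible s)
    (hm' : m'.Admissible s) (h : m.weight = m'.weight) : m = m' := by
  have h0 : m.m₁ = m'.m₁ := congrFun h 0
  have h1 : m.m₆ - m.m₂ = m'.m₆ - m'.m₂ := congrFun h 1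
  have h2 : m.m₂ = m'.m₂ := congrFun h 2
  have h3 : m.m₅ - m.m₃ = m'.m₅ - m'.m₃ := congrFun h 3
  have h4 : m.m₃ + m.m₄' = m'.m₃ + m'.m₄' := congrFun h 4
  have h5 : m.m₇ - m.m₄ - m.m₅ = m'.m₇ - m'.m₄ - m'.m₅ := congrFun h 5
  obtain ⟨a1, a2, a3, a4, a5⟩ := hm
  obtain ⟨b1, b2, b3, b4, b5⟩ := hm'
  ext <;> omega

theorem dominates_highestLetter : ∀ k l : Fin 8, k ≤ l → ¬(k = 3 ∧ l = 4) →
    Dominates CartanMatrix.E₇ (highestLetter k) (highestLetter l) := by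
  -- The coefficients of the simple roots are half the coordinates given by `doubleInverse`.
  have key : ∀ k l : Fin 8, k ≤ l → ¬(k = 3 ∧ l = 4) → ∀ j,
      highestLetter k j = highestLetter l j + ∑ i, CartanMatrix.E₇ j i *
        ((∑ t, doubleInverse i t * (highestLetter k t - highestLetter l t)) / 2).toNat := by
    decide +kernel
  exact fun k l h h' => ⟨_, key k l h h'⟩

/-- The two incomparable letters do not occur together because `min m₄ m₄' = 0`. -/
theorem Tuple.Admissible.isChain_word {s : ℕ} {m : Tuple} (hm : m.Admissible s) :
    m.word.IsChain (Dominates CartanMatrix.E₇) := by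
  refine List.Pairwise.isChain ?_
  rw [Tuple.word, List.pairwise_flatMap]
  refine ⟨fun l _ => List.pairwise_replicate.2 (.inr (Dominates.refl _)), ?_⟩
  refine (List.pairwise_lt_finRange 8).imp fun {k l} hkl x hx y hy => ?_
  obtain ⟨hk, rfl⟩ := List.mem_replicate.1 hx
  obtain ⟨hl, rfl⟩ := List.mem_replicate.1 hy
  refine dominates_highestLetter k l hkl.le ?_
  rintro ⟨rfl, rfl⟩
  have hk : m.m₄' ≠ 0 := hk
  have hl : m.m₄ ≠ 0 := hl
  have := hm.min_eq
  omega

theorem Tuple.Admissible.latticeWord_word {s : ℕ} {m : Tuple} (hm : m.Admissible s) :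
    LatticeWord (Set.range levi) m.word := by
  obtain ⟨h1, h2, h3, -, -⟩ := hm
  rw [Tuple.word_eq]
  repeat' apply LatticeWord.replicate_append
  · trivial
  all_goals
    rw [Set.forall_mem_range]
    intro k
    try simp only [List.map_append, List.map_replicate, List.sum_append, List.sum_replicate]
    fin_cases k <;> simp [levi, highestLetter] <;> omega

/-- A tensor factor that may precede a word in the eight letters is again one of them. Here a
coordinate `-1` has to be compensated by a letter of the word. -/
theorem eq_highestLetter : ∀ x ∈ minusculeWeights,
    (∀ k : Fin 6, x (levi k) = -1 →
      ∃ l, RootGE x (highestLetter l) ∧ 0 < highestLetter l (levi k)) →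
    ∃ l, x = highestLetter l := by
  decide +kernel

/-- Prepending a letter to the word of an admissible tuple gives another such word, provided that it
dominates all letters present and that the weight stays dominant. -/
theorem Tuple.Admissible.exists_cons_word_eq {m : Tuple} (hm : m.Admissible m.word.length)
    (l : Fin 8) (hz : ∀ l', ¬RootGE (highestLetter l) (highestLetter l') → m.count l' = 0)
    (hdom : ∀ k : Fin 6, 0 ≤ highestLetter l (levi k) + (m.word.map (· (levi k))).sum) :
    ∃ m' : Tuple, m'.Admissible (highestLetter l :: m.word).length ∧
      highestLetter l :: m.word = m'.word := by
  simp only [Tuple.sum_word] at hdom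
  have d0 := hdom 0
  have d1 := hdom 1
  have d2 := hdom 2
  have d3 := hdom 3
  have d4 := hdom 4
  have d5 := hdom 5
  obtain ⟨h1, h2, h3, h4, h5⟩ := hm
  have key : ∀ m' : Tuple, m'.Admissible (m.word.length + 1) →
      m'.word = highestLetter l :: m.word →
      ∃ m' : Tuple, m'.Admissible (highestLetter l :: m.word).length ∧
        highestLetter l :: m.word = m'.word := fun m' h h' => ⟨m', h, h'.symm⟩
  rw [Tuple.length_word] at key h5
  rw [Tuple.word_eq] at key
  have hl : ∀ l : Fin 8, l = 0 ∨ l = 1 ∨ l = 2 ∨ l = 3 ∨ l = 4 ∨ l = 5 ∨ l = 6 ∨ l = 7 := by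
    decide
  rcases hl l with rfl | rfl | rfl | rfl | rfl | rfl | rfl | rfl
  · simp [levi, highestLetter] at d0 d1 d2 d3 d4 d5
    refine key { m with m₁ := m.m₁ + 1 } ?_ ?_
    · constructor <;> simp only <;> omega
    · simp [Tuple.word_eq, List.replicate_succ]
  · have z0 : m.m₁ = 0 := hz 0 (by decide +kernel)
    simp [levi, highestLetter] at d0 d1 d2 d3 d4 d5
    refine key { m with m₂ := m.m₂ + 1 } ?_ ?_
    · constructor <;> simp only <;> omega
    · simp [Tuple.word_eq, List.replicate_succ, z0]
  · have z0 : m.m₁ = 0 := hz 0 (by decide +kernel)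
    have z1 : m.m₂ = 0 := hz 1 (by decide +kernel)
    simp [levi, highestLetter] at d0 d1 d2 d3 d4 d5
    refine key { m with m₃ := m.m₃ + 1 } ?_ ?_
    · constructor <;> simp only <;> omega
    · simp [Tuple.word_eq, List.replicate_succ, z0, z1]
  · have z0 : m.m₁ = 0 := hz 0 (by decide +kernel)
    have z1 : m.m₂ = 0 := hz 1 (by decide +kernel)
    have z2 : m.m₃ = 0 := hz 2 (by decide +kernel)
    have z4 : m.m₄ = 0 := hz 4 (by decide +kernel)
    simp [levi, highestLetter] at d0 d1 d2 d3 d4 d5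
    refine key { m with m₄' := m.m₄' + 1 } ?_ ?_
    · constructor <;> simp only <;> omega
    · simp [Tuple.word_eq, List.replicate_succ, z0, z1, z2, z4]
  · have z0 : m.m₁ = 0 := hz 0 (by decide +kernel)
    have z1 : m.m₂ = 0 := hz 1 (by decide +kernel)
    have z2 : m.m₃ = 0 := hz 2 (by decide +kernel)
    have z3 : m.m₄' = 0 := hz 3 (by decide +kernel)
    simp [levi, highestLetter] at d0 d1 d2 d3 d4 d5
    refine key { m with m₄ := m.m₄ + 1 } ?_ ?_
    · constructor <;> simp only <;> omega
    · simp [Tuple.word_eq, List.replicate_succ, z0, z1, z2, z3]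
  · have z0 : m.m₁ = 0 := hz 0 (by decide +kernel)
    have z1 : m.m₂ = 0 := hz 1 (by decide +kernel)
    have z2 : m.m₃ = 0 := hz 2 (by decide +kernel)
    have z3 : m.m₄' = 0 := hz 3 (by decide +kernel)
    have z4 : m.m₄ = 0 := hz 4 (by decide +kernel)
    simp [levi, highestLetter] at d0 d1 d2 d3 d4 d5
    refine key { m with m₅ := m.m₅ + 1 } ?_ ?_
    · constructor <;> simp only <;> omega
    · simp [Tuple.word_eq, List.replicate_succ, z0, z1, z2, z3, z4]
  · have z0 : m.m₁ = 0 := hz 0 (by decide +kernel)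
    have z1 : m.m₂ = 0 := hz 1 (by decide +kernel)
    have z2 : m.m₃ = 0 := hz 2 (by decide +kernel)
    have z3 : m.m₄' = 0 := hz 3 (by decide +kernel)
    have z4 : m.m₄ = 0 := hz 4 (by decide +kernel)
    have z5 : m.m₅ = 0 := hz 5 (by decide +kernel)
    simp [levi, highestLetter] at d0 d1 d2 d3 d4 d5
    refine key { m with m₆ := m.m₆ + 1 } ?_ ?_
    · constructor <;> simp only <;> omega
    · simp [Tuple.word_eq, List.replicate_succ, z0, z1, z2, z3, z4, z5]
  · have z0 : m.m₁ = 0 := hz 0 (by decide +kernel)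
    have z1 : m.m₂ = 0 := hz 1 (by decide +kernel)
    have z2 : m.m₃ = 0 := hz 2 (by decide +kernel)
    have z3 : m.m₄' = 0 := hz 3 (by decide +kernel)
    have z4 : m.m₄ = 0 := hz 4 (by decide +kernel)
    have z5 : m.m₅ = 0 := hz 5 (by decide +kernel)
    have z6 : m.m₆ = 0 := hz 6 (by decide +kernel)
    simp [levi, highestLetter] at d0 d1 d2 d3 d4 d5
    refine key { m with m₇ := m.m₇ + 1 } ?_ ?_
    · constructor <;> simp only <;> omega
    · simp [Tuple.word_eq, List.replicate_succ, z0, z1, z2, z3, z4, z5, z6]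

/-- Every chain in the 56 weights all of whose suffixes are `A₆`-dominant is the word of an
admissible tuple. -/
theorem exists_word_eq : ∀ w : List (Fin 7 → ℤ), (∀ y ∈ w, y ∈ minusculeWeights) →
    w.Pairwise (Dominates CartanMatrix.E₇) → LatticeWord (Set.range levi) w →
    ∃ m : Tuple, m.Admissible w.length ∧ w = m.word
  | [], _, _, _ => ⟨⟨0, 0, 0, 0, 0, 0, 0, 0⟩, ⟨le_rfl, le_rfl, le_rfl, rfl, rfl⟩, rfl⟩
  | x :: t, hmem, hpair, hlat => by
    obtain ⟨hx, hpair⟩ := List.pairwise_cons.1 hpair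
    obtain ⟨hlat, hdom⟩ := hlat
    obtain ⟨m, hm, rfl⟩ := exists_word_eq t (fun y hy => hmem y (List.mem_cons_of_mem _ hy))
      hpair hlat
    rw [Set.forall_mem_range] at hdom
    obtain ⟨l, rfl⟩ := eq_highestLetter x (hmem x List.mem_cons_self) fun k hk => by
      have h1 := hdom k
      rw [hk] at h1
      by_contra! h2
      have h3 : (m.word.map (· (levi k))).sum ≤ 0 := by
        refine (List.sum_le_card_nsmul _ 0 fun z hz => ?_).trans_eq (nsmul_zero _)
        obtain ⟨y, hy, rfl⟩ := List.mem_map.1 hz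
        obtain ⟨l, -, rfl⟩ := Tuple.mem_word.1 hy
        exact h2 l (hx _ hy).rootGE
      omega
    have hz : ∀ l', ¬RootGE (highestLetter l) (highestLetter l') → m.count l' = 0 := by
      intro l' h
      by_contra h0
      exact h (hx _ (Tuple.mem_word.2 ⟨l', Nat.pos_of_ne_zero h0, rfl⟩)).rootGE
    exact hm.exists_cons_word_eq l hz hdom

/-! ### The crystals of type `A₆` and the decomposition -/

theorem isSimplyLaced_A₆ : IsSimplyLaced (CartanMatrix.A 6) where
  diag := diag_A₆
  symm i j := by fin_cases i <;> fin_cases j <;> rfl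
  off_diag i j h := by
    fin_cases i <;> fin_cases j <;> first | exact .inl rfl | exact .inr rfl | exact absurd rfl h

/-- The coefficients are those of twice the half-sum of the positive coroots, a functional with the
value `2` on all simple roots. -/
theorem isGraded_A₆ {B : Crystal (CartanMatrix.A 6)} {n : ℕ} (hB : ∀ x j, |B.wt x j| ≤ n) :
    B.IsGraded (depth ![6, 10, 12, 12, 10, 6] n) :=
  isGraded_depth (by decide +kernel) hB

section A₆

variable (a : Fin 6 → ℕ)

theorem isStembridge_crystalA₆ : (crystalA₆ a).IsStembridge :=
  (isStembridge_minusculeTensor isSimplyLaced_A₆ _).component _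

theorem wt_bounds_crystalA₆ (x : (crystalA₆ a).carrier) (j : Fin 6) :
    |(crystalA₆ a).wt x j| ≤ (∑ k, a k : ℕ) := by
  have h := wt_bounds diag_A₆ j _ x.1
  have h1 : ((List.finRange 6).flatMap fun k => List.replicate (a k)
      (⟨Pi.single k 1, isMinuscule_A₆ k⟩ : {l // IsMinuscule (CartanMatrix.A 6) l})).length =
        ∑ k, a k := by
    simp [Fin.sum_univ_succ, List.finRange_succ]
  rwa [h1] at h

theorem wt_topElement_A₆ (j : Fin 6) : (minusculeTensor (CartanMatrix.A 6) diag_A₆ _).wt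
    (topElement (CartanMatrix.A 6) diag_A₆ ((List.finRange 6).flatMap fun k =>
      List.replicate (a k) ⟨Pi.single k 1, isMinuscule_A₆ k⟩)) j = a j := by
  rw [wt_topElement]
  fin_cases j <;> simp [List.finRange_succ]

variable {a}

theorem isHighest_crystalA₆_iff {x : (crystalA₆ a).carrier} :
    (crystalA₆ a).IsHighest x ↔ x = ⟨topElement (CartanMatrix.A 6) diag_A₆ _, .refl⟩ := by
  refine isHighest_component_iff.trans ⟨fun h => Subtype.ext ?_, ?_⟩
  · exact (isStembridge_minusculeTensor isSimplyLaced_A₆ _).raising.eq_of_reach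
      (isGraded_A₆ fun x j => wt_bounds diag_A₆ j _ x) (isHighest_topElement diag_A₆ _) h x.2
  · rintro rfl
    exact isHighest_topElement diag_A₆ _

theorem wt_of_isHighest_crystalA₆ {x : (crystalA₆ a).carrier} (h : (crystalA₆ a).IsHighest x)
    (j : Fin 6) : (crystalA₆ a).wt x j = a j := by
  rw [isHighest_crystalA₆_iff.1 h]
  exact wt_topElement_A₆ a j

/-- The highest weight is an isomorphism invariant of the crystals of type `A₆`. -/
theorem eq_of_iso_crystalA₆ {b : Fin 6 → ℕ} (F : Iso (crystalA₆ a) (crystalA₆ b)) : a = b := by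
  set x : (crystalA₆ a).carrier := ⟨topElement (CartanMatrix.A 6) diag_A₆ _, .refl⟩ with hx
  have h1 : (crystalA₆ a).IsHighest x := isHighest_crystalA₆_iff.2 hx
  have h2 : (crystalA₆ b).IsHighest (F.toEquiv x) := by
    rw [isHighest_iff] at h1 ⊢
    intro i
    rw [F.eps_eq, h1]
  funext j
  have h3 := wt_of_isHighest_crystalA₆ h1 j
  have h4 := wt_of_isHighest_crystalA₆ h2 j
  rw [F.wt_eq, h3] at h4
  exact_mod_cast h4

end A₆

theorem Tuple.Admissible.sum_weight_le {s : ℕ} {m : Tuple} (hm : m.Admissible s) :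
    ∑ k, m.weight k ≤ s := by
  obtain ⟨h1, h2, h3, h4, h5⟩ := hm
  simp [Tuple.weight, Fin.sum_univ_succ]
  omega

/-- The restriction of `B(s ϖ₇)` to the Levi subalgebra of type `A₆`. -/
abbrev leviCrystal (s : ℕ) : Crystal (CartanMatrix.A 6) := (crystalE₇ s).restrict levi levi_spec

theorem isStembridge_leviCrystal (s : ℕ) : (leviCrystal s).IsStembridge :=
  ((isStembridge_minusculeTensor isSimplyLaced_E₇ _).component _).restrict levi_spec (by decide)

theorem isHighest_leviCrystal_iff {s : ℕ} {x : (leviCrystal s).carrier} :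
    (leviCrystal s).IsHighest x ↔ LatticeWord (Set.range levi) (letters diag_E₇ _ x.1) := by
  rw [latticeWord_letters_iff, Set.forall_mem_range, isHighest_iff]
  rfl

theorem WeylOrbit.foldl {I : Type} {A : Matrix I I ℤ} {l : I → ℤ} (p : List I) {μ : I → ℤ}
    (h : WeylOrbit A l μ) : WeylOrbit A l (p.foldl (fun μ i j => μ j - μ i * A j i) μ) := by
  induction p generalizing μ with
  | nil => exact h
  | cons i p ih => exact ih (h.reflect i)

theorem weylOrbit_highestLetter (l : Fin 8) :
    WeylOrbit CartanMatrix.E₇ (Pi.single 6 1) (highestLetter l) := by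
  -- Each letter is reached from `ϖ₇` by applying the simple reflections with the listed indices.
  have key : ∀ l, highestLetter l =
      ((![[],
      [6, 5],
      [6, 5, 4, 3],
      [6, 5, 4, 3, 1],
      [6, 5, 4, 3, 2, 0],
      [6, 5, 4, 3, 1, 2, 0],
      [6, 5, 4, 3, 1, 2, 0, 3, 2, 4, 3, 1],
      [6, 5, 4, 3, 1, 2, 0, 3, 2, 4, 3, 1, 5, 4, 3, 2, 6, 5, 4, 3, 1]] :
        Fin 8 → List (Fin 7)) l).foldl
        (fun μ i j => μ j - μ i * CartanMatrix.E₇ j i) (Pi.single 6 1) := by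
    decide +kernel
  rw [key]
  exact .foldl _ .base

/-- The highest weight elements of `B(s ϖ₇)` for `A₆` are matched with those of `B(μ_m)`. -/
theorem highestMatching (s : ℕ) : HighestMatching
    (C := leviCrystal s)
    (D := directSum fun m : {m : Tuple // m.Admissible s} => crystalA₆ m.1.weight)
    (fun u v => (leviCrystal s).IsHighest u ∧ (crystalA₆ v.1.1.weight).IsHighest v.2 ∧
      letters diag_E₇ _ u.1 = v.1.1.word) where
  highest_left h := h.1
  highest_right h := isHighest_directSum_iff.2 h.2.1
  wt_eq := by
    rintro u ⟨m, v⟩ ⟨h1, h2, h3⟩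
    funext j
    have h4 : (leviCrystal s).wt u j = ((letters diag_E₇ _ u.1).map (· (levi j))).sum :=
      wt_eq_sum_letters diag_E₇ (levi j) _ u.1
    rw [h4, h3, m.2.sum_word_eq_weight]
    exact wt_of_isHighest_crystalA₆ h2 j
  exists_right u hu := by
    have hlen := length_letters diag_E₇ _ u.1
    rw [List.length_replicate] at hlen
    obtain ⟨m, hm, hw⟩ := exists_word_eq (letters diag_E₇ _ u.1)
      (fun y hy => mem_minusculeWeights (weylOrbit_of_mem_letters diag_E₇ s u.1 y hy))
      (List.isChain_iff_pairwise.1 (reach_top_iff.1 u.2)) (isHighest_leviCrystal_iff.1 hu)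
    rw [hlen] at hm
    exact ⟨⟨⟨m, hm⟩, ⟨topElement (CartanMatrix.A 6) diag_A₆ _, .refl⟩⟩, hu,
      isHighest_crystalA₆_iff.2 rfl, hw⟩
  exists_left := by
    rintro ⟨⟨m, hm⟩, v⟩ hv
    have hlen : m.word.length = s := m.length_word.trans hm.sum_eq
    obtain ⟨x, hx⟩ := exists_letters_eq diag_E₇ (l := ⟨Pi.single 6 1, isMinuscule_E₇⟩) m.word
      fun y hy => by
        obtain ⟨l, -, rfl⟩ := Tuple.mem_word.1 hy
        exact weylOrbit_highestLetter l
    subst hlen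
    have hc : Chain isSimplyLaced_E₇ x := by
      rw [Chain, hx]
      exact hm.isChain_word
    have hl : LatticeWord (Set.range levi) (letters diag_E₇ _ x) := by
      rw [hx]
      exact hm.latticeWord_word
    exact ⟨⟨x, reach_top_iff.2 hc⟩, isHighest_leviCrystal_iff.2 hl,
      isHighest_directSum_iff.1 hv, hx⟩
  right_unique := by
    rintro u ⟨m, v⟩ ⟨m', v'⟩ ⟨-, h2, h3⟩ ⟨-, h5, h6⟩
    obtain rfl : m = m' := by
      refine Subtype.ext (m.2.eq_of_weight_eq m'.2 (funext fun k => ?_))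
      have h7 := m.2.sum_word_eq_weight k
      rw [← h3, h6, m'.2.sum_word_eq_weight] at h7
      exact_mod_cast h7.symm
    rw [isHighest_crystalA₆_iff] at h2 h5
    simp only at h2 h5
    rw [h2, h5]
  left_unique := by
    rintro u u' v ⟨-, -, h3⟩ ⟨-, -, h6⟩
    exact Subtype.ext (letters_injective diag_E₇ _ (h3.trans h6.symm))

end CrystalDecomp

open CrystalDecomp in
theorem mainTheorem3 (s : ℕ) :
    Nonempty (CrystalDecomp.Crystal.Iso
      ((CrystalDecomp.crystalE₇ s).restrict CrystalDecomp.levi CrystalDecomp.levi_spec)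
      (CrystalDecomp.Crystal.directSum
        fun m : {m : CrystalDecomp.Tuple // m.Admissible s} =>
          CrystalDecomp.crystalA₆ m.1.weight)) ∧
    ∀ m m' : {m : CrystalDecomp.Tuple // m.Admissible s},
      Nonempty (CrystalDecomp.Crystal.Iso
        (CrystalDecomp.crystalA₆ m.1.weight) (CrystalDecomp.crystalA₆ m'.1.weight)) →
      m = m' := by
  refine ⟨(highestMatching s).nonempty_iso isSimplyLaced_A₆ (isGraded_A₆ (n := s) fun x j => ?_)
    (isGraded_A₆ (n := s) fun x j => ?_) (isStembridge_leviCrystal s)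
    (Crystal.isStembridge_directSum fun m => isStembridge_crystalA₆ _), ?_⟩
  · have h := wt_bounds diag_E₇ (levi j) _ x.1
    rw [List.length_replicate] at h
    exact h
  · refine (wt_bounds_crystalA₆ x.1.1.weight x.2 j).trans ?_
    exact_mod_cast x.1.2.sum_weight_le
  · rintro m m' ⟨F⟩
    exact Subtype.ext (m.2.eq_of_weight_eq m'.2 (eq_of_iso_crystalA₆ F))
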